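/- **Theorem.** Let $0<\alpha<1$, $\theta>-\alpha$, and let $\nu=(\nu_k)_{k\ge1}$ be any probability distribution on the positive integers. The *Hollywood process* with parameter $(\alpha,\theta,\nu)$ is defined from a random sequence of finite lists $X_1,X_2,\dots$ of vertices as follows. Given $X_1,\dots,X_{n-1}$, the length $K_n$ of $X_n$ is drawn from $\nu$, independently of the past. Given $K_n=m$, the entries $X_{n,1},\dots,X_{n,m}$ are drawn one after the other: if $V$ distinct vertices, labeled $1,\dots,V$ in order of appearance, occur among all entries drawn so far, and vertex $i$ occurs $D(i)$ times among them, then the next entry equals $i$ with probability proportional to $D(i)-\alpha$ for $i=1,\dots,V$, and equals the new vertex $V+1$ with probability proportional to $\theta+\alpha V$; the very first entry is $1$. Let $\mathcal Y_n$ be the edge-labeled network with edges $X_1,\dots,X_n$ (the vertex labels being forgotten), let $v(\mathcal Y_n)$ be the number of its non-isolated vertices, and for $k\ge1$ let $N_k(\mathcal Y_n)$ be the number of vertices of degree $k$, that is, those that occur exactly $k$ times, with multiplicity, among the entries of $X_1,\dots,X_n$. Write $x^{\uparrow j}=x(x+1)\cdots(x+j-1)$, $x^{\uparrow 0}=1$,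 and $p_\alpha(k)=\alpha(1-\alpha)^{\uparrow(k-1)}/k!$. Then, almost surely, $$\lim_{n\to\infty}\frac{N_k(\mathcal Y_n)}{v(\mathcal Y_n)}=p_\alpha(k)\qquad\text{for every }k\ge1,$$ and the limit satisfies $$p_\alpha(k)\sim\frac{\alpha\,k^{-(\alpha+1)}}{\Gamma(1-\alpha)}\qquad\text{as }k\to\infty .$$ Consequently, almost surely, $(\mathcal Y_n)_{n\ge1}$ has a power law degree distribution with exponent $\gamma=1+\alpha\in(1,2)$: there is a slowly varying function $\ell$ (measurable, eventually positive, with $\ell(tx)/\ell(x)\to1$ as $x\to\infty$ for every $t>0$) such that, for all sufficiently large $k$, $N_k(\mathcal Y_n)/v(\mathcal Y_n)\sim\ell(k)\,k^{-\gamma}$ as $n\to\infty$. -/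

import Mathlib

open Filter Topology Asymptotics MeasureTheory

/-! Edge-labeled networks. A finite ordered multiset of vertices is a list, and the vertices
are labeled by `ℕ`, as only the cardinality of the label set matters. -/

/-- An interaction process with `n` interactions: interaction `i` lists its participants in order,
with repetitions allowed. -/
abbrev InteractionProcess (n : ℕ) : Type := Fin n → List ℕ

namespace InteractionProcess

/-- The action of a relabeling `ρ` of the population. -/
def relabel {n : ℕ} (ρ : Equiv.Perm ℕ) (I : InteractionProcess n) : InteractionProcess n :=
  fun i => (I i).map ρ

/-- Two interaction processes are equivalent if they differ by a relabeling of the population. -/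
instance relabelSetoid (n : ℕ) : Setoid (InteractionProcess n) where
  r I J := ∃ ρ : Equiv.Perm ℕ, relabel ρ I = J
  iseqv :=
    { refl := fun I => ⟨1, by funext i; simp [relabel]⟩
      symm := by
        rintro I J ⟨ρ, rfl⟩
        exact ⟨ρ.symm, by funext i; simp [relabel]⟩
      trans := by
        rintro I J K ⟨ρ, rfl⟩ ⟨τ, rfl⟩
        exact ⟨ρ.trans τ, by funext i; simp [relabel]⟩ }

/-- The number of times the vertex `a` appears in the interactions. -/
def degree {n : ℕ} (I : InteractionProcess n) (a : ℕ) : ℕ := ∑ i, (I i).count a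

/-- The vertices involved in at least one interaction. -/
def vertices {n : ℕ} (I : InteractionProcess n) : Set ℕ := {a | ∃ i, a ∈ I i}

theorem degree_relabel {n : ℕ} (ρ : Equiv.Perm ℕ) (I : InteractionProcess n) (a : ℕ) :
    degree (relabel ρ I) (ρ a) = degree I a := by
  simp only [degree, relabel]
  exact Finset.sum_congr rfl fun i _ => List.count_map_of_injective _ _ ρ.injective _

theorem vertices_relabel {n : ℕ} (ρ : Equiv.Perm ℕ) (I : InteractionProcess n) :
    vertices (relabel ρ I) = ρ '' vertices I := by
  ext b
  simp only [vertices, relabel, List.mem_map, Set.mem_ofPred_eq, Set.mem_image]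
  constructor
  · rintro ⟨i, a, ha, rfl⟩
    exact ⟨a, ⟨i, ha⟩, rfl⟩
  · rintro ⟨a, ⟨i, ha⟩, rfl⟩
    exact ⟨i, a, ha, rfl⟩

theorem degreeSet_relabel {n : ℕ} (ρ : Equiv.Perm ℕ) (I : InteractionProcess n) (k : ℕ) :
    {b | b ∈ vertices (relabel ρ I) ∧ degree (relabel ρ I) b = k} =
      ρ '' {a | a ∈ vertices I ∧ degree I a = k} := by
  ext b
  obtain ⟨a, rfl⟩ := ρ.surjective b
  rw [vertices_relabel, Set.mem_ofPred_eq, degree_relabel, ρ.injective.mem_set_image,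
    ρ.injective.mem_set_image]
  rfl

end InteractionProcess

/-- Edge-labeled networks with `n` edges: interaction processes up to relabeling of the vertices. -/
def EdgeLabeledNetwork (n : ℕ) : Type := Quotient (InteractionProcess.relabelSetoid n)

namespace EdgeLabeledNetwork

/-- The edge-labeled network induced by an interaction process. -/
def ofInteractions {n : ℕ} (I : InteractionProcess n) : EdgeLabeledNetwork n :=
  Quotient.mk (InteractionProcess.relabelSetoid n) I

/-- The number `v(E)` of non-isolated vertices. -/
noncomputable def numVertices {n : ℕ} (E : EdgeLabeledNetwork n) : ℕ :=
  Quotient.lift (fun I : InteractionProcess n => I.vertices.ncard)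
    (by
      rintro I J ⟨ρ, rfl⟩
      rw [InteractionProcess.vertices_relabel, Set.ncard_image_of_injective _ ρ.injective]) E

/-- The number `N_k(E)` of (non-isolated) vertices that appear exactly `k` times. -/
noncomputable def numDegree {n : ℕ} (E : EdgeLabeledNetwork n) (k : ℕ) : ℕ :=
  Quotient.lift
    (fun I : InteractionProcess n => {a | a ∈ I.vertices ∧ I.degree a = k}.ncard)
    (by
      rintro I J ⟨ρ, rfl⟩
      rw [InteractionProcess.degreeSet_relabel, Set.ncard_image_of_injective _ ρ.injective]) E

/-- The proportion `d_k(E) = N_k(E) / v(E)` of vertices of degree `k`. -/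
noncomputable def degreeProportion {n : ℕ} (E : EdgeLabeledNetwork n) (k : ℕ) : ℝ :=
  (E.numDegree k : ℝ) / (E.numVertices : ℝ)

end EdgeLabeledNetwork

/-- Slowly varying functions at infinity. -/
def IsSlowlyVarying (l : ℝ → ℝ) : Prop :=
  Measurable l ∧ (∀ᶠ x in atTop, 0 < l x) ∧
    ∀ t : ℝ, 0 < t → Tendsto (fun x => l (t * x) / l x) atTop (𝓝 1)

/-- The sequence `E n` of networks with `n` edges has a power law degree distribution with
exponent `γ > 1`: for some slowly varying `l` and all large `k`,
`d_k(E n) ∼ l(k) k ^ (-γ)` as `n → ∞`. -/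
def HasPowerLawDegree (E : ∀ n : ℕ, EdgeLabeledNetwork n) (γ : ℝ) : Prop :=
  1 < γ ∧ ∃ l : ℝ → ℝ, IsSlowlyVarying l ∧
    ∀ᶠ k : ℕ in atTop,
      (fun n : ℕ => (E n).degreeProportion k) ~[atTop] fun _ => l (k : ℝ) * (k : ℝ) ^ (-γ)

/-! The Hollywood process. Actors are labeled `1, 2, …` in order of appearance. -/

namespace Hollywood

/-- The number of distinct actors among the roles `past` filled so far. -/
def numActors (past : List ℕ) : ℕ := past.toFinset.card

/-- The unnormalized weight of casting actor `i` when the roles `past` have been filled: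
`D(i) - α` for an actor `i = 1, …, V` seen before, where `D(i)` is the number of roles given to `i`,
and `θ + α V` for the new actor `V + 1`. -/
noncomputable def castWeight (α θ : ℝ) (past : List ℕ) (i : ℕ) : ℝ :=
  if i = numActors past + 1 then θ + α * numActors past
  else if 1 ≤ i ∧ i ≤ numActors past then (past.count i : ℝ) - α
  else 0

/-- The conditional probability of casting actor `i` next when the roles `past` have been filled.
The very first role is given to actor `1`, the only candidate (whose weight `θ` may be `≤ 0`). -/
noncomputable def castProb (α θ : ℝ) (past : List ℕ) (i : ℕ) : ℝ :=
  if past = [] then (if i = 1 then 1 else 0)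
  else castWeight α θ past i / ∑ j ∈ Finset.Icc 1 (numActors past + 1), castWeight α θ past j

/-- The conditional probability that the roles of a movie are given, in order, to the actors in
the list, when `past` are the roles of the earlier movies and the number of roles of this movie is
the length of the list. -/
noncomputable def movieProb (α θ : ℝ) : List ℕ → List ℕ → ℝ
  | _, [] => 1
  | past, i :: rest => castProb α θ past i * movieProb α θ (past ++ [i]) rest

/-- All roles of the movies `x 0, …, x (n - 1)`, in order. -/
def rolesBefore (x : ℕ → List ℕ) (n : ℕ) : List ℕ := ((List.range n).map x).flatten

/-- `X 0, X 1, …` are the interactions of a Hollywood process with parameter `(α, θ, ν)`: given the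
earlier movies, the number of roles of the next movie has law `ν` independently of the past, and
given this number the roles are filled one after the other with probabilities `castProb`. The
conditional probabilities are written in the product form `P(A ∩ B) = P(A) P(B | A)`. -/
structure IsInteractionSequence {Ω : Type*} [MeasurableSpace Ω] (P : Measure Ω) (α θ : ℝ)
    (ν : PMF ℕ) (X : ℕ → Ω → List ℕ) : Prop where
  measurableSet_eq : ∀ (n : ℕ) (r : List ℕ), MeasurableSet {ω | X n ω = r}
  prob_succ : ∀ (n : ℕ) (x : ℕ → List ℕ),
    P {ω | ∀ i < n + 1, X i ω = x i} =
      P {ω | ∀ i < n, X i ω = x i} *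
        (ν (x n).length * ENNReal.ofReal (movieProb α θ (rolesBefore x n) (x n)))

/-- The network `Y_n` induced by the first `n` interactions. -/
def network {Ω : Type*} (X : ℕ → Ω → List ℕ) (n : ℕ) (ω : Ω) : EdgeLabeledNetwork n :=
  EdgeLabeledNetwork.ofInteractions fun i : Fin n => X i ω

/-- `p_α(k) = α (1 - α)^{↑(k-1)} / k!` for `k ≥ 1`. -/
noncomputable def limitDegree (α : ℝ) (k : ℕ) : ℝ :=
  α * (ascPochhammer ℝ (k - 1)).eval (1 - α) / (k.factorial : ℝ)

end Hollywood

/-! ### Deterministic recursions -/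

/-! Movie lengths carry no information about the casting. Concatenating the movies therefore gives
one sequence of roles that is filled by `castProb` alone (`isCastingSequence_role`), and the
networks are this sequence read at random times tending to infinity.

Along the roles, let L be their number, V the number of actors and q_j the proportion of actors with
at least j roles. The conditional mean of the change of q_{k+2} is 1/(L+θ) times (k+1-α) q_{k+1} -
(k+1) q_{k+2} + O(1/V), by `castMean_tailProportion`. This is a stochastic approximation scheme. If
q_{k+1} converges, V → ∞ and the summed noise converges, then q_{k+2} tends to the zero of the drift
(`tendsto_of_stochastic_approximation`). Starting from q_1 = 1, induction gives the limits
(1-α)^{↑k}/k! of q_{k+1}, whose successive differences are p_α.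

The function 1/V controls the rest. Its expected decrease in one step dominates the mean square
change of q_{k+2} (`exists_castMean_tailProportion_sq_le`), so the noise is an L²-bounded
martingale. Its mean also contracts to 0, which forces V → ∞ almost surely. The asymptotics of p_α
come from Euler's limit formula for Γ at -α. -/

theorem tendsto_zero_of_le_contraction {u a e : ℕ → ℝ} {c : ℝ} (hc : 0 < c)
    (hu : ∀ n, 0 ≤ u n) (ha : ∀ n, 0 ≤ a n) (ha0 : Tendsto a atTop (𝓝 0))
    (hdiv : Tendsto (fun n => ∑ i ∈ Finset.range n, a i) atTop atTop)
    (he : Tendsto e atTop (𝓝 0))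
    (h : ∀ n, u (n + 1) ≤ |1 - c * a n| * u n + a n * e n) :
    Tendsto u atTop (𝓝 0) := by
  rw [Metric.tendsto_atTop]
  intro δ hδ
  have h1 : ∀ᶠ n in atTop, e n ≤ c * (δ / 2) :=
    he.eventually_le_const (by positivity)
  have h2 : ∀ᶠ n in atTop, a n ≤ 1 / c := ha0.eventually_le_const (by positivity)
  obtain ⟨N, hN⟩ := eventually_atTop.1 (h1.and h2)
  -- Once e n ≤ c δ/2, the excess of u over δ/2 shrinks by the factor 1 - c a n ≤ exp(-c a n), and
  -- the divergence of ∑ a drives it to 0.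
  set v : ℕ → ℝ := fun n => max (u n - δ / 2) 0 with hv
  have hv0 : ∀ n, 0 ≤ v n := fun n => le_max_right _ _
  have hstep : ∀ n ≥ N, v (n + 1) ≤ Real.exp (-(c * a n)) * v n := by
    intro n hn
    obtain ⟨g1, g2⟩ := hN n hn
    have g3 : c * a n ≤ 1 := by
      rw [le_div_iff₀ hc] at g2; linarith
    have g4 : 1 - c * a n ≤ Real.exp (-(c * a n)) := by
      have := Real.add_one_le_exp (-(c * a n)); linarith
    have g5 := h n
    rw [abs_of_nonneg (by linarith)] at g5
    have g6 : a n * e n ≤ a n * (c * (δ / 2)) := mul_le_mul_of_nonneg_left g1 (ha n)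
    refine max_le ?_ (mul_nonneg (Real.exp_pos _).le (hv0 n))
    calc u (n + 1) - δ / 2 ≤ (1 - c * a n) * (u n - δ / 2) := by nlinarith
      _ ≤ (1 - c * a n) * v n := mul_le_mul_of_nonneg_left (le_max_left _ _) (by linarith)
      _ ≤ _ := mul_le_mul_of_nonneg_right g4 (hv0 n)
  set S : ℕ → ℝ := fun n => ∑ i ∈ Finset.range n, a i with hS
  have hbound : ∀ n ≥ N, v n ≤ v N * Real.exp (c * S N) * Real.exp (-(c * S n)) := by
    intro n hn
    induction n, hn using Nat.le_induction with
    | base => rw [mul_assoc, ← Real.exp_add]; simp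
    | succ n hn ih =>
      refine (hstep n hn).trans ((mul_le_mul_of_nonneg_left ih (Real.exp_pos _).le).trans_eq ?_)
      have : S (n + 1) = S n + a n := Finset.sum_range_succ _ _
      rw [this, mul_add, neg_add, Real.exp_add]
      ring
  have hlim : Tendsto (fun n => v N * Real.exp (c * S N) * Real.exp (-(c * S n))) atTop (𝓝 0) := by
    have : Tendsto (fun n => Real.exp (-(c * S n))) atTop (𝓝 0) :=
      Real.tendsto_exp_neg_atTop_nhds_zero.comp (hdiv.const_mul_atTop hc)
    simpa using this.const_mul (v N * Real.exp (c * S N))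
  obtain ⟨N', hN'⟩ := eventually_atTop.1 (hlim.eventually_lt_const (half_pos hδ))
  refine ⟨max N N', fun n hn => ?_⟩
  have k1 := hbound n ((le_max_left _ _).trans hn)
  have k2 := hN' n ((le_max_right _ _).trans hn)
  have k3 : u n - δ / 2 ≤ v n := le_max_left _ _
  rw [Real.dist_eq, sub_zero, abs_of_nonneg (hu n)]
  linarith

/-- Convergence of a stochastic approximation recursion whose noise has a convergent sum. -/
theorem tendsto_of_stochastic_approximation {x a b G : ℕ → ℝ} {c β s : ℝ} (hc : 0 < c)
    (ha : ∀ n, 0 ≤ a n) (ha0 : Tendsto a atTop (𝓝 0))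
    (hdiv : Tendsto (fun n => ∑ i ∈ Finset.range n, a i) atTop atTop)
    (hb : Tendsto b atTop (𝓝 (c * β))) (hG : Tendsto G atTop (𝓝 s))
    (hx : ∀ n, x (n + 1) = x n + a n * (b n - c * x n) + (G (n + 1) - G n)) :
    Tendsto x atTop (𝓝 β) := by
  -- Adding the noise still to come, s - G n, removes the noise from the recursion and leaves only a
  -- vanishing perturbation of the drift.
  have hy : Tendsto (fun n => |x n + (s - G n) - β|) atTop (𝓝 0) := by
    have he : Tendsto (fun n => |b n - c * β + c * (s - G n)|) atTop (𝓝 0) := by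
      have := ((hb.sub_const (c * β)).add ((hG.const_sub s).const_mul c)).abs
      simpa using this
    refine tendsto_zero_of_le_contraction hc (fun n => abs_nonneg _) ha ha0 hdiv he fun n => ?_
    have : x (n + 1) + (s - G (n + 1)) - β =
        (1 - c * a n) * (x n + (s - G n) - β) + a n * (b n - c * β + c * (s - G n)) := by
      rw [hx]; ring
    rw [this, ← abs_mul]
    refine (abs_add_le _ _).trans_eq ?_
    rw [abs_mul (a n), abs_of_nonneg (ha n)]
  have h1 := (tendsto_zero_iff_abs_tendsto_zero _).2 hy
  have h2 := (h1.add_const β).sub (hG.const_sub s)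
  simp only [zero_add, sub_self, sub_zero] at h2
  exact h2.congr fun n => by ring

theorem tendsto_one_div_natCast_add (t : ℝ) :
    Tendsto (fun n : ℕ => 1 / ((n : ℝ) + t)) atTop (𝓝 0) :=
  tendsto_const_nhds.div_atTop (tendsto_natCast_atTop_atTop.atTop_add tendsto_const_nhds)

theorem tendsto_sum_one_div_natCast_add {t : ℝ} (ht : 0 < t) :
    Tendsto (fun n : ℕ => ∑ i ∈ Finset.range n, 1 / ((i : ℝ) + t)) atTop atTop := by
  rw [← not_summable_iff_tendsto_nat_atTop_of_nonneg fun n => by positivity]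
  have h := (Real.summable_one_div_nat_add_rpow t 1).not.2 (lt_irrefl _)
  refine fun hs => h (hs.congr fun n => ?_)
  rw [Real.rpow_one, abs_of_pos (by positivity)]

/-! ### Casting one role -/

namespace Hollywood

/-- The actors are labeled `1, …, V` without gaps. -/
def IsLabeled (z : List ℕ) : Prop := z.toFinset = Finset.Icc 1 (numActors z)

theorem isLabeled_nil : IsLabeled [] := by simp [IsLabeled, numActors]

theorem IsLabeled.mem_iff {z : List ℕ} (hz : IsLabeled z) {i : ℕ} :
    i ∈ z ↔ 1 ≤ i ∧ i ≤ numActors z := by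
  rw [← List.mem_toFinset, hz, Finset.mem_Icc]

theorem IsLabeled.new_notMem {z : List ℕ} (hz : IsLabeled z) : numActors z + 1 ∉ z := by
  rw [hz.mem_iff]; omega

theorem numActors_append_of_mem {z : List ℕ} {i : ℕ} (hi : i ∈ z) :
    numActors (z ++ [i]) = numActors z := by
  simp [numActors, List.toFinset_append, hi]

theorem numActors_append_of_notMem {z : List ℕ} {i : ℕ} (hi : i ∉ z) :
    numActors (z ++ [i]) = numActors z + 1 := by
  rw [numActors, List.toFinset_append, Finset.card_union_of_disjoint (by simpa using hi)]
  simp [numActors]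

theorem numActors_pos {z : List ℕ} (hz : z ≠ []) : 0 < numActors z := by
  rw [numActors, Finset.card_pos]
  exact List.toFinset_nonempty_iff z |>.2 hz

theorem IsLabeled.append {z : List ℕ} (hz : IsLabeled z) {i : ℕ}
    (hi : i ∈ Finset.Icc 1 (numActors z + 1)) : IsLabeled (z ++ [i]) := by
  rw [Finset.mem_Icc] at hi
  by_cases h : i ∈ z
  · rw [IsLabeled, numActors_append_of_mem h, ← hz]
    ext a; simp only [List.mem_toFinset, List.mem_append, List.mem_singleton]
    constructor
    · rintro (h' | rfl) <;> assumption
    · exact Or.inl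
  · have : i = numActors z + 1 := by rw [hz.mem_iff] at h; omega
    rw [IsLabeled, numActors_append_of_notMem h]
    ext a
    simp only [List.mem_toFinset, List.mem_append, List.mem_singleton, hz.mem_iff, Finset.mem_Icc]
    omega

theorem castWeight_of_mem {α θ : ℝ} {z : List ℕ} (hz : IsLabeled z) {i : ℕ} (hi : i ∈ z) :
    castWeight α θ z i = (z.count i : ℝ) - α := by
  have := hz.mem_iff.1 hi
  rw [castWeight, if_neg (by omega), if_pos this]

theorem castWeight_new {α θ : ℝ} {z : List ℕ} :
    castWeight α θ z (numActors z + 1) = θ + α * numActors z := by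
  rw [castWeight, if_pos rfl]

theorem sum_castWeight_mul {α θ : ℝ} {z : List ℕ} (hz : IsLabeled z) (g : ℕ → ℝ) :
    ∑ i ∈ Finset.Icc 1 (numActors z + 1), castWeight α θ z i * g i =
      ∑ i ∈ z.toFinset, ((z.count i : ℝ) - α) * g i +
        (θ + α * numActors z) * g (numActors z + 1) := by
  rw [Finset.sum_Icc_succ_top (by omega), castWeight_new, ← hz]
  congr 1
  exact Finset.sum_congr rfl fun i hi => by rw [castWeight_of_mem hz (List.mem_toFinset.1 hi)]

/-- The discounts -α of the V seen actors cancel the α V in the weight of the newcomer. -/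
theorem sum_castWeight {α θ : ℝ} {z : List ℕ} (hz : IsLabeled z) :
    ∑ i ∈ Finset.Icc 1 (numActors z + 1), castWeight α θ z i = z.length + θ := by
  have h := sum_castWeight_mul (α := α) (θ := θ) hz fun _ => 1
  simp only [mul_one] at h
  rw [h, Finset.sum_sub_distrib, Finset.sum_const, ← Nat.cast_sum,
    List.sum_toFinset_count_eq_length, nsmul_eq_mul, numActors]
  ring

/-- The conditional mean of `f` after the next role, when the roles `z` have been filled. -/
noncomputable def castMean (α θ : ℝ) (f : List ℕ → ℝ) (z : List ℕ) : ℝ :=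
  ∑ i ∈ Finset.Icc 1 (numActors z + 1), castProb α θ z i * f (z ++ [i])

theorem castMean_eq {α θ : ℝ} {z : List ℕ} (hz : IsLabeled z) (hz' : z ≠ []) (f : List ℕ → ℝ) :
    castMean α θ f z = (∑ i ∈ z.toFinset, ((z.count i : ℝ) - α) * f (z ++ [i]) +
        (θ + α * numActors z) * f (z ++ [numActors z + 1])) / (z.length + θ) := by
  rw [castMean, ← sum_castWeight_mul hz fun i => f (z ++ [i]), ← sum_castWeight (α := α) hz,
    Finset.sum_div]
  refine Finset.sum_congr rfl fun i _ => ?_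
  rw [castProb, if_neg hz']
  ring

theorem length_add_pos {α θ : ℝ} (hα : α < 1) (hθ : -α < θ) {z : List ℕ} (hz' : z ≠ []) :
    0 < (z.length : ℝ) + θ := by
  have : (1 : ℝ) ≤ z.length := by exact_mod_cast List.length_pos_iff.2 hz'
  linarith

theorem newWeight_pos {α θ : ℝ} (hα : 0 < α) (hθ : -α < θ) {z : List ℕ} (hz' : z ≠ []) :
    0 < θ + α * numActors z := by
  have : (1 : ℝ) ≤ numActors z := by exact_mod_cast numActors_pos hz'
  nlinarith

theorem castProb_nonneg {α θ : ℝ} (hα₀ : 0 < α) (hα₁ : α < 1) (hθ : -α < θ) {z : List ℕ}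
    (hz : IsLabeled z) (i : ℕ) : 0 ≤ castProb α θ z i := by
  rw [castProb]
  split_ifs with h h'
  · exact zero_le_one
  · exact le_rfl
  rw [sum_castWeight hz]
  refine div_nonneg ?_ (length_add_pos hα₁ hθ h).le
  rw [castWeight]
  split_ifs with h1 h2
  · exact (newWeight_pos hα₀ hθ h).le
  · have : (1 : ℝ) ≤ z.count i := by
      exact_mod_cast List.count_pos_iff.2 (hz.mem_iff.2 h2)
    linarith
  · exact le_rfl

theorem castProb_eq_zero {α θ : ℝ} {z : List ℕ} {i : ℕ}
    (hi : i ∉ Finset.Icc 1 (numActors z + 1)) : castProb α θ z i = 0 := by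
  rw [Finset.mem_Icc] at hi
  rw [castProb]
  split_ifs with h h'
  · subst h'; omega
  · rfl
  · rw [castWeight, if_neg (by omega), if_neg (by omega), zero_div]

theorem sum_castProb {α θ : ℝ} (hα₁ : α < 1) (hθ : -α < θ) {z : List ℕ} (hz : IsLabeled z) :
    ∑ i ∈ Finset.Icc 1 (numActors z + 1), castProb α θ z i = 1 := by
  by_cases h : z = []
  · subst h
    simp [castProb, numActors]
  · simp only [castProb, if_neg h]
    rw [← Finset.sum_div, div_self]
    rw [sum_castWeight hz]
    exact (length_add_pos hα₁ hθ h).ne'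

theorem castMean_sub_self {α θ : ℝ} (hα₁ : α < 1) (hθ : -α < θ) {z : List ℕ} (hz : IsLabeled z)
    (f : List ℕ → ℝ) : castMean α θ f z - f z = castMean α θ (fun y => f y - f z) z := by
  simp only [castMean, mul_sub, Finset.sum_sub_distrib]
  rw [← Finset.sum_mul, sum_castProb hα₁ hθ hz, one_mul]

/-- The variance is at most the mean square deviation from the current value. -/
theorem castMean_sq_sub_castMean_le {α θ : ℝ} (hα₁ : α < 1) (hθ : -α < θ) {z : List ℕ}
    (hz : IsLabeled z) (f : List ℕ → ℝ) (g : ℝ) :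
    castMean α θ (fun y => (g + (f y - castMean α θ f z)) ^ 2) z ≤
      g ^ 2 + castMean α θ (fun y => (f y - f z) ^ 2) z := by
  have h1 := sum_castProb (α := α) hα₁ hθ hz
  have h2 : ∀ a b : ℝ, castMean α θ (fun y => (a + (f y - b)) ^ 2) z =
      castMean α θ (fun y => f y ^ 2) z + 2 * (a - b) * castMean α θ f z + (a - b) ^ 2 := by
    intro a b
    rw [← one_mul ((a - b) ^ 2), ← h1]
    simp only [castMean, Finset.mul_sum, Finset.sum_mul, ← Finset.sum_add_distrib]
    exact Finset.sum_congr rfl fun i _ => by ring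
  have h3 := h2 0 (f z)
  simp only [zero_add] at h3
  rw [h2, h3]
  nlinarith [sq_nonneg (castMean α θ f z - f z)]

/-! ### Degree counts of a list of roles -/

/-- The number of actors with at least `k` roles. -/
def numAtLeast (k : ℕ) (z : List ℕ) : ℕ := (z.toFinset.filter fun a => k ≤ z.count a).card

theorem numAtLeast_one (z : List ℕ) : numAtLeast 1 z = numActors z := by
  rw [numAtLeast, numActors, Finset.filter_true_of_mem]
  intro a ha
  exact List.count_pos_iff.2 (List.mem_toFinset.1 ha)

theorem numAtLeast_le (k : ℕ) (z : List ℕ) : numAtLeast k z ≤ numActors z :=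
  Finset.card_filter_le _ _

theorem card_count_eq_add (k : ℕ) (z : List ℕ) :
    (z.toFinset.filter fun a => z.count a = k).card + numAtLeast (k + 1) z = numAtLeast k z := by
  rw [numAtLeast, numAtLeast, ← Finset.card_union_of_disjoint]
  · congr 1
    ext a
    simp only [Finset.mem_union, Finset.mem_filter]
    grind
  · rw [Finset.disjoint_filter]
    intros; omega

theorem numAtLeast_append_of_mem {k : ℕ} {z : List ℕ} {i : ℕ} (hi : i ∈ z) :
    numAtLeast (k + 1) (z ++ [i]) = numAtLeast (k + 1) z + if z.count i = k then 1 else 0 := by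
  have ht : (z ++ [i]).toFinset = z.toFinset := by
    ext a; simp only [List.mem_toFinset, List.mem_append, List.mem_singleton]
    constructor
    · rintro (h' | rfl) <;> assumption
    · exact Or.inl
  simp only [numAtLeast, ht, List.count_append, List.count_singleton]
  simp only [Finset.card_filter]
  rw [← Finset.sum_ite_eq' z.toFinset i (fun a => if z.count a = k then 1 else 0) |>.trans
    (if_pos (List.mem_toFinset.2 hi)), ← Finset.sum_add_distrib]
  refine Finset.sum_congr rfl fun a _ => ?_
  by_cases h : a = i
  · subst h; simp only [beq_self_eq_true, if_true]; split_ifs <;> omega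
  · have : (i == a) = false := by simpa using fun h' => h h'.symm
    simp [h, this]

/-- A newcomer has exactly one role and so misses every threshold from 2 on. -/
theorem numAtLeast_append_of_notMem {k : ℕ} {z : List ℕ} {i : ℕ} (hi : i ∉ z) :
    numAtLeast (k + 2) (z ++ [i]) = numAtLeast (k + 2) z := by
  rw [numAtLeast, numAtLeast]
  congr 1
  ext a
  simp only [Finset.mem_filter, List.mem_toFinset, List.mem_append, List.mem_singleton,
    List.count_append, List.count_singleton]
  by_cases h : a = i
  · subst h
    simp [hi, List.count_eq_zero_of_not_mem hi]
  · have : (i == a) = false := by simpa using fun h' => h h'.symm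
    simp [h, this]

/-! ### One-step moments of the tail proportions -/

/-- The proportion of actors with at least `k` roles. -/
noncomputable def tailProportion (k : ℕ) (z : List ℕ) : ℝ := numAtLeast k z / numActors z

theorem tailProportion_nonneg (k : ℕ) (z : List ℕ) : 0 ≤ tailProportion k z := by
  unfold tailProportion; positivity

theorem tailProportion_le_one (k : ℕ) (z : List ℕ) : tailProportion k z ≤ 1 :=
  div_le_one_of_le₀ (by exact_mod_cast numAtLeast_le k z) (by positivity)

theorem castMean_inv_numActors {α θ : ℝ} (hα₁ : α < 1) (hθ : -α < θ) {z : List ℕ}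
    (hz : IsLabeled z) (hz' : z ≠ []) :
    castMean α θ (fun y => 1 / (numActors y : ℝ)) z = 1 / (numActors z : ℝ) -
      (θ + α * numActors z) / (numActors z * (numActors z + 1)) / (z.length + θ) := by
  have h := castMean_sub_self hα₁ hθ hz fun y => 1 / (numActors y : ℝ)
  rw [castMean_eq hz hz' fun y => 1 / (numActors y : ℝ) - _, Finset.sum_eq_zero,
    numActors_append_of_notMem hz.new_notMem] at h
  · have hV : (0 : ℝ) < numActors z := by exact_mod_cast numActors_pos hz'
    have : (1 : ℝ) / ((numActors z + 1 : ℕ) : ℝ) - 1 / numActors z =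
        - (1 / (numActors z * (numActors z + 1))) := by
      push_cast; field_simp; ring
    rw [this] at h
    linear_combination h
  · intro i hi
    rw [numActors_append_of_mem (List.mem_toFinset.1 hi), sub_self, mul_zero]

/-- Only two events move the proportion: an actor with exactly k+1 roles is cast again, or a
newcomer enlarges the denominator. Taking φ as the identity gives the drift, and as the square the
mean square increment. -/
theorem castMean_tailProportion_comp {α θ : ℝ} {z : List ℕ}
    (hz : IsLabeled z) (hz' : z ≠ []) (k : ℕ) (φ : ℝ → ℝ) (hφ : φ 0 = 0) :
    castMean α θ (fun y => φ (tailProportion (k + 2) y - tailProportion (k + 2) z)) z =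
      (((k + 1 : ℝ) - α) * (numAtLeast (k + 1) z - numAtLeast (k + 2) z) *
          φ (1 / numActors z) +
        (θ + α * numActors z) *
          φ (-(tailProportion (k + 2) z / (numActors z + 1)))) / (z.length + θ) := by
  have hV : (0 : ℝ) < numActors z := by exact_mod_cast numActors_pos hz'
  rw [castMean_eq hz hz']
  congr 2
  · have h1 : ∀ i ∈ z.toFinset, ((z.count i : ℝ) - α) *
        φ (tailProportion (k + 2) (z ++ [i]) - tailProportion (k + 2) z) =
        if z.count i = k + 1 then ((k + 1 : ℝ) - α) * φ (1 / numActors z) else 0 := by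
      intro i hi
      rw [List.mem_toFinset] at hi
      rw [tailProportion, tailProportion, numActors_append_of_mem hi, numAtLeast_append_of_mem hi]
      split_ifs with h
      · rw [h]; push_cast; congr 2; ring
      · simp [hφ]
    rw [Finset.sum_congr rfl h1, ← Finset.sum_filter, Finset.sum_const, nsmul_eq_mul]
    have := card_count_eq_add (k + 1) z
    have h2 : ((z.toFinset.filter fun a => z.count a = k + 1).card : ℝ) =
        numAtLeast (k + 1) z - numAtLeast (k + 2) z := by
      rw [eq_sub_iff_add_eq]; exact_mod_cast this
    rw [h2]; ring
  · rw [tailProportion, tailProportion, numActors_append_of_notMem hz.new_notMem,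
      numAtLeast_append_of_notMem hz.new_notMem]
    congr 2
    push_cast
    field_simp
    ring

theorem castMean_tailProportion {α θ : ℝ} (hα₁ : α < 1) (hθ : -α < θ) {z : List ℕ}
    (hz : IsLabeled z) (hz' : z ≠ []) (k : ℕ) :
    castMean α θ (tailProportion (k + 2)) z = tailProportion (k + 2) z +
      1 / (z.length + θ) * (((k + 1 - α) * tailProportion (k + 1) z +
        (α - θ) * (1 / (numActors z + 1)) * tailProportion (k + 2) z) -
          (k + 1) * tailProportion (k + 2) z) := by
  have h := castMean_sub_self hα₁ hθ hz (tailProportion (k + 2))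
  rw [castMean_tailProportion_comp hz hz' k (fun x => x) rfl] at h
  have hV : (0 : ℝ) < numActors z := by exact_mod_cast numActors_pos hz'
  have hL := length_add_pos hα₁ hθ hz'
  rw [sub_eq_iff_eq_add.1 h, tailProportion, tailProportion]
  field_simp
  ring

theorem exists_castMean_tailProportion_sq_le {α θ : ℝ} (hα₀ : 0 < α) (hα₁ : α < 1) (hθ : -α < θ)
    (k : ℕ) : ∃ C : ℝ, 0 ≤ C ∧ ∀ z, IsLabeled z → z ≠ [] →
      castMean α θ (fun y => (tailProportion (k + 2) y - tailProportion (k + 2) z) ^ 2) z ≤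
        C * (1 / (numActors z : ℝ) - castMean α θ (fun y => 1 / (numActors y : ℝ)) z) := by
  -- Since V ≥ 1, this c satisfies c V ≤ θ + α V for either sign of θ. Both squared jumps, weighted,
  -- are then at most a constant times W/(V(V+1)), the weighted decrease of 1/V.
  set c := min α (θ + α)
  have hc : 0 < c := lt_min hα₀ (by linarith)
  refine ⟨2 * (k + 1) / c + 1, by positivity, fun z hz hz' => ?_⟩
  rw [castMean_tailProportion_comp hz hz' k (fun x => x ^ 2) (by simp),
    castMean_inv_numActors hα₁ hθ hz hz', sub_sub_cancel, ← mul_div_assoc]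
  refine div_le_div_of_nonneg_right ?_ (length_add_pos hα₁ hθ hz').le
  have hV : (1 : ℝ) ≤ numActors z := by exact_mod_cast numActors_pos hz'
  have hW : c * numActors z ≤ θ + α * numActors z := by
    rcases le_total 0 θ with h | h
    · have : c ≤ α := min_le_left _ _
      nlinarith
    · have : c ≤ θ + α := min_le_right _ _
      nlinarith
  have hW0 := newWeight_pos hα₀ hθ hz'
  have hN : (numAtLeast (k + 1) z : ℝ) - numAtLeast (k + 2) z ≤ numActors z := by
    have : (numAtLeast (k + 1) z : ℝ) ≤ numActors z := by exact_mod_cast numAtLeast_le _ z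
    have : (0 : ℝ) ≤ numAtLeast (k + 2) z := by positivity
    linarith
  have hN0 : 0 ≤ (numAtLeast (k + 1) z : ℝ) - numAtLeast (k + 2) z := by
    have : numAtLeast (k + 2) z ≤ numAtLeast (k + 1) z := by
      rw [← card_count_eq_add (k + 1) z]; exact Nat.le_add_left _ _
    rw [sub_nonneg]; exact_mod_cast this
  have hq0 := tailProportion_nonneg (k + 2) z
  have hq1 := tailProportion_le_one (k + 2) z
  set V : ℝ := (numActors z : ℝ)
  set W := θ + α * V
  set N := (numAtLeast (k + 1) z : ℝ) - numAtLeast (k + 2) z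
  set q := tailProportion (k + 2) z
  have e1 : ((k + 1 : ℝ) - α) * N * (1 / V) ^ 2 ≤ 2 * (k + 1) / c * (W / (V * (V + 1))) := by
    calc ((k + 1 : ℝ) - α) * N * (1 / V) ^ 2 ≤ (k + 1) * V * (1 / V) ^ 2 := by
          gcongr
          · linarith
      _ = 2 * (k + 1) / c * ((c * V) / (V * (2 * V))) := by field_simp
      _ ≤ 2 * (k + 1) / c * (W / (V * (V + 1))) := by gcongr; linarith
  have e2 : W * (-(q / (V + 1))) ^ 2 ≤ 1 * (W / (V * (V + 1))) := by
    calc W * (-(q / (V + 1))) ^ 2 = W * q ^ 2 / ((V + 1) * (V + 1)) := by field_simp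
      _ ≤ W * 1 / (V * (V + 1)) := by
          gcongr
          · exact pow_le_one₀ hq0 hq1
          · linarith
      _ = _ := by ring
  calc _ ≤ _ := add_le_add e1 e2
    _ = _ := by ring

end Hollywood

/-! ### The sequence of all roles -/

namespace Hollywood

section

theorem movieProb_append (α θ : ℝ) (p a b : List ℕ) :
    movieProb α θ p (a ++ b) = movieProb α θ p a * movieProb α θ (p ++ a) b := by
  induction a generalizing p with
  | nil => simp [movieProb]
  | cons i a ih => simp [movieProb, ih, mul_assoc]

theorem movieProb_nil_append_singleton (α θ : ℝ) (z : List ℕ) (i : ℕ) :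
    movieProb α θ [] (z ++ [i]) = movieProb α θ [] z * castProb α θ z i := by
  simp [movieProb_append, movieProb]

/-- After a list with gaps in its labels `castProb` can be negative, so both claims go through one
induction. -/
theorem movieProb_nil_nonneg_and {α θ : ℝ} (hα₀ : 0 < α) (hα₁ : α < 1) (hθ : -α < θ)
    (z : List ℕ) : 0 ≤ movieProb α θ [] z ∧ (movieProb α θ [] z ≠ 0 → IsLabeled z) := by
  induction z using List.reverseRecOn with
  | nil => exact ⟨by simp [movieProb], fun _ => isLabeled_nil⟩
  | append_singleton z i ih =>
    rw [movieProb_nil_append_singleton]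
    by_cases h : movieProb α θ [] z = 0
    · simp [h]
    have hz := ih.2 h
    refine ⟨mul_nonneg ih.1 (castProb_nonneg hα₀ hα₁ hθ hz i), fun h' => hz.append ?_⟩
    by_contra hi
    exact h' (by rw [castProb_eq_zero hi, mul_zero])

variable {Ω : Type*}

/-- The first `m` terms of the sequence `Z`. -/
def history {β : Type*} (Z : ℕ → Ω → β) (m : ℕ) (ω : Ω) : List β := (List.range m).map fun j => Z j ω

theorem history_succ {β : Type*} (Z : ℕ → Ω → β) (m : ℕ) (ω : Ω) :
    history Z (m + 1) ω = history Z m ω ++ [Z m ω] := by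
  simp [history, List.range_succ]

@[simp] theorem length_history {β : Type*} (Z : ℕ → Ω → β) (m : ℕ) (ω : Ω) :
    (history Z m ω).length = m := by simp [history]

theorem history_succ_ne_nil {β : Type*} (Z : ℕ → Ω → β) (m : ℕ) (ω : Ω) : history Z (m + 1) ω ≠ [] := by
  simp [history_succ]

/-- The lists of `m` roles that occur with actors labeled in order of appearance. -/
def labeledLists : ℕ → Finset (List ℕ)
  | 0 => {[]}
  | m + 1 => (labeledLists m).biUnion fun z =>
      (Finset.Icc 1 (numActors z + 1)).image fun i => z ++ [i]

theorem labeledLists_spec {m : ℕ} {z : List ℕ} (hz : z ∈ labeledLists m) :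
    IsLabeled z ∧ z.length = m := by
  induction m generalizing z with
  | zero =>
    rw [labeledLists, Finset.mem_singleton] at hz
    subst hz; exact ⟨isLabeled_nil, rfl⟩
  | succ m ih =>
    simp only [labeledLists, Finset.mem_biUnion, Finset.mem_image] at hz
    obtain ⟨y, hy, i, hi, rfl⟩ := hz
    exact ⟨(ih hy).1.append hi, by simp [(ih hy).2]⟩

theorem sum_labeledLists_succ (m : ℕ) (g : List ℕ → ℝ) :
    ∑ z ∈ labeledLists (m + 1), g z =
      ∑ z ∈ labeledLists m, ∑ i ∈ Finset.Icc 1 (numActors z + 1), g (z ++ [i]) := by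
  rw [labeledLists, Finset.sum_biUnion]
  · refine Finset.sum_congr rfl fun z _ => Finset.sum_image fun i _ j _ h => ?_
    simpa using h
  · intro y _ z _ hyz
    refine Finset.disjoint_left.2 fun x hx hx' => hyz ?_
    obtain ⟨i, -, rfl⟩ := Finset.mem_image.1 hx
    obtain ⟨j, -, h⟩ := Finset.mem_image.1 hx'
    exact (List.append_inj_left' h rfl).symm

theorem numActors_history_mono (Z : ℕ → Ω → ℕ) (ω : Ω) :
    Monotone fun n => numActors (history Z n ω) := by
  refine monotone_nat_of_le_succ fun n => ?_
  rw [history_succ]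
  exact Finset.card_le_card (by simp [List.toFinset_append])

variable [MeasurableSpace Ω]

/-- The roles `Z 0, Z 1, …` are filled one after the other with probabilities `castProb`. -/
structure IsCastingSequence (P : Measure Ω) (α θ : ℝ) (Z : ℕ → Ω → ℕ) : Prop where
  measurableSet_fiber : ∀ j i, MeasurableSet (Z j ⁻¹' {i})
  law : ∀ z : List ℕ,
    P {ω | history Z z.length ω = z} = ENNReal.ofReal (movieProb α θ [] z)

theorem measurableSet_history_preimage {β : Type*} [Countable β] {Z : ℕ → Ω → β}
    (hZ : ∀ j i, MeasurableSet (Z j ⁻¹' {i})) (m : ℕ) (S : Set (List β)) : MeasurableSet (history Z m ⁻¹' S) := by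
  induction m generalizing S with
  | zero => exact MeasurableSet.const ([] ∈ S)
  | succ m ih =>
    have : history Z (m + 1) ⁻¹' S =
        ⋃ i : β, Z m ⁻¹' {i} ∩ history Z m ⁻¹' {z | z ++ [i] ∈ S} := by
      ext ω
      simp [history_succ]
    rw [this]
    exact MeasurableSet.iUnion fun i => (hZ m i).inter (ih _)

variable {P : Measure Ω} {α θ : ℝ} {Z : ℕ → Ω → ℕ}

theorem IsCastingSequence.ae_mem_labeledLists (hZ : IsCastingSequence P α θ Z) :
    ∀ᵐ ω ∂P, ∀ m, history Z m ω ∈ labeledLists m := by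
  have h : ∀ᵐ ω ∂P, ∀ (z : List ℕ) (i : ℕ), i ∉ Finset.Icc 1 (numActors z + 1) →
      history Z (z ++ [i]).length ω ≠ z ++ [i] := by
    rw [ae_all_iff]; intro z
    rw [ae_all_iff]; intro i
    by_cases hi : i ∈ Finset.Icc 1 (numActors z + 1)
    · simp [hi]
    · have := hZ.law (z ++ [i])
      rw [movieProb_nil_append_singleton, castProb_eq_zero hi, mul_zero, ENNReal.ofReal_zero] at this
      have := measure_eq_zero_iff_ae_notMem.1 this
      filter_upwards [this] with ω hω _ using hω
  filter_upwards [h] with ω hω m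
  induction m with
  | zero => simp [history, labeledLists]
  | succ m ih =>
    simp only [labeledLists, Finset.mem_biUnion, Finset.mem_image]
    refine ⟨_, ih, Z m ω, ?_, (history_succ _ _ _).symm⟩
    by_contra hi
    refine hω _ _ hi ?_
    rw [← history_succ, length_history]

variable [IsProbabilityMeasure P]

/-- Almost surely the history lies in the finite set `labeledLists m`. Integrability is thus
automatic, and finite sums with `castMean` can stand in for conditional expectations. -/
theorem IsCastingSequence.integrable_and_integral (hZ : IsCastingSequence P α θ Z)
    (hα₀ : 0 < α) (hα₁ : α < 1) (hθ : -α < θ) (m : ℕ) (f : List ℕ → ℝ) :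
    Integrable (fun ω => f (history Z m ω)) P ∧
      ∫ ω, f (history Z m ω) ∂P = ∑ z ∈ labeledLists m, movieProb α θ [] z * f z := by
  have hae : (fun ω => ∑ z ∈ labeledLists m,
      (history Z m ⁻¹' {z}).indicator (fun _ => f z) ω) =ᵐ[P] fun ω => f (history Z m ω) := by
    filter_upwards [hZ.ae_mem_labeledLists] with ω hω
    rw [Finset.sum_eq_single (history Z m ω)]
    · simp
    · intro z _ hz
      simp [hz.symm]
    · intro h; exact absurd (hω m) h
  have hint : ∀ z ∈ labeledLists m,
      Integrable ((history Z m ⁻¹' {z}).indicator fun _ => f z) P := fun z _ =>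
    (integrable_const _).indicator (measurableSet_history_preimage hZ.measurableSet_fiber m _)
  refine ⟨(integrable_finsetSum _ hint).congr hae, ?_⟩
  rw [← integral_congr_ae hae, integral_finsetSum _ hint]
  refine Finset.sum_congr rfl fun z hz => ?_
  rw [integral_indicator_const _ (measurableSet_history_preimage hZ.measurableSet_fiber m _), smul_eq_mul]
  congr 1
  have := hZ.law z
  rw [(labeledLists_spec hz).2] at this
  rw [Measure.real, show history Z m ⁻¹' {z} = {ω | history Z m ω = z} from rfl, this,
    ENNReal.toReal_ofReal (movieProb_nil_nonneg_and hα₀ hα₁ hθ z).1]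

theorem IsCastingSequence.integrable (hZ : IsCastingSequence P α θ Z)
    (hα₀ : 0 < α) (hα₁ : α < 1) (hθ : -α < θ) (m : ℕ) (f : List ℕ → ℝ) :
    Integrable (fun ω => f (history Z m ω)) P :=
  (hZ.integrable_and_integral hα₀ hα₁ hθ m f).1

theorem IsCastingSequence.integral_succ (hZ : IsCastingSequence P α θ Z)
    (hα₀ : 0 < α) (hα₁ : α < 1) (hθ : -α < θ) (m : ℕ) (f : List ℕ → ℝ) :
    ∫ ω, f (history Z (m + 1) ω) ∂P = ∫ ω, castMean α θ f (history Z m ω) ∂P := by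
  rw [(hZ.integrable_and_integral hα₀ hα₁ hθ _ f).2,
    (hZ.integrable_and_integral hα₀ hα₁ hθ _ (castMean α θ f)).2, sum_labeledLists_succ]
  refine Finset.sum_congr rfl fun z _ => ?_
  rw [castMean, Finset.mul_sum]
  refine Finset.sum_congr rfl fun i _ => ?_
  rw [movieProb_nil_append_singleton, mul_assoc]

theorem IsCastingSequence.integral_mono (hZ : IsCastingSequence P α θ Z)
    (hα₀ : 0 < α) (hα₁ : α < 1) (hθ : -α < θ) (m : ℕ) {f g : List ℕ → ℝ}
    (h : ∀ z, IsLabeled z → z ≠ [] → f z ≤ g z) :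
    ∫ ω, f (history Z (m + 1) ω) ∂P ≤ ∫ ω, g (history Z (m + 1) ω) ∂P := by
  refine integral_mono_ae (hZ.integrable hα₀ hα₁ hθ _ f) (hZ.integrable hα₀ hα₁ hθ _ g) ?_
  filter_upwards [hZ.ae_mem_labeledLists] with ω hω
  exact h _ (labeledLists_spec (hω _)).1 (history_succ_ne_nil _ _ _)

/-! ### Martingale convergence of the prediction errors -/

/-- The accumulated prediction errors of `f` along the roles `z`. -/
noncomputable def castNoise (α θ : ℝ) (f : List ℕ → ℝ) (z : List ℕ) : ℝ :=
  ∑ i ∈ Finset.range (z.length - 1), (f (z.take (i + 2)) - castMean α θ f (z.take (i + 1)))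

theorem castNoise_append (f : List ℕ → ℝ) {z : List ℕ} (hz : z ≠ []) (i : ℕ) :
    castNoise α θ f (z ++ [i]) = castNoise α θ f z + (f (z ++ [i]) - castMean α θ f z) := by
  obtain ⟨n, hn⟩ : ∃ n, z.length = n + 1 := Nat.exists_eq_succ_of_ne_zero (by simpa using hz)
  rw [castNoise, castNoise, List.length_append, List.length_singleton, hn, Nat.add_sub_cancel,
    Nat.add_sub_cancel, Finset.sum_range_succ]
  congr 1
  · refine Finset.sum_congr rfl fun j hj => ?_
    rw [Finset.mem_range] at hj
    rw [List.take_append_of_le_length (by omega), List.take_append_of_le_length (by omega)]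
  · rw [List.take_of_length_le (by simp [hn]), List.take_append_of_le_length (by omega),
      List.take_of_length_le (by omega)]

theorem castMean_congr {f g : List ℕ → ℝ} {z : List ℕ} (h : ∀ i, f (z ++ [i]) = g (z ++ [i])) :
    castMean α θ f z = castMean α θ g z :=
  Finset.sum_congr rfl fun i _ => by rw [h]

theorem castMean_castNoise (hα₁ : α < 1) (hθ : -α < θ) (f : List ℕ → ℝ) {z : List ℕ}
    (hz : IsLabeled z) (hz' : z ≠ []) : castMean α θ (castNoise α θ f) z = castNoise α θ f z := by
  rw [castMean_congr (g := fun y => castNoise α θ f z + (f y - castMean α θ f z))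
    fun i => castNoise_append f hz' i]
  simp only [castMean, mul_add, mul_sub, Finset.sum_add_distrib, Finset.sum_sub_distrib]
  rw [← Finset.sum_mul, ← Finset.sum_mul, sum_castProb hα₁ hθ hz]
  simp

/-- The filtration generated by the roles, started when the first role has been filled. -/
def historyFiltration (hZ : ∀ j i, MeasurableSet (Z j ⁻¹' {i})) :
    Filtration ℕ ‹MeasurableSpace Ω› where
  seq n := MeasurableSpace.comap (history Z (n + 1)) ⊤
  mono' := monotone_nat_of_le_succ fun n => by
    rintro _ ⟨S, -, rfl⟩
    refine ⟨{z | z.dropLast ∈ S}, trivial, ?_⟩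
    ext ω
    simp [history_succ]
  le' n := by
    rintro _ ⟨S, -, rfl⟩
    exact measurableSet_history_preimage hZ _ S

theorem IsCastingSequence.martingale_castNoise (hZ : IsCastingSequence P α θ Z)
    (hα₀ : 0 < α) (hα₁ : α < 1) (hθ : -α < θ) (f : List ℕ → ℝ) :
    Martingale (fun n ω => castNoise α θ f (history Z (n + 1) ω))
      (historyFiltration hZ.measurableSet_fiber) P := by
  refine martingale_of_setIntegral_eq_succ (fun n => ?_)
    (fun n => hZ.integrable hα₀ hα₁ hθ _ _) ?_
  · refine Measurable.stronglyMeasurable ?_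
    intro T _
    exact ⟨castNoise α θ f ⁻¹' T, trivial, rfl⟩
  · rintro n _ ⟨S, -, rfl⟩
    have hS := measurableSet_history_preimage hZ.measurableSet_fiber (n + 1) S
    rw [← integral_indicator hS, ← integral_indicator hS]
    -- Through `dropLast`, the past event becomes a function of the longer history, to which
    -- `integral_succ` applies.
    have h1 : ((history Z (n + 1) ⁻¹' S).indicator
        fun ω => castNoise α θ f (history Z (n + 1 + 1) ω)) =
        fun ω => ((List.dropLast ⁻¹' S).indicator (castNoise α θ f)) (history Z (n + 1 + 1) ω) := by
      funext ω
      have : (history Z (n + 1 + 1) ω).dropLast = history Z (n + 1) ω := by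
        simp [history_succ _ (n + 1)]
      by_cases h : history Z (n + 1) ω ∈ S
      · rw [Set.indicator_of_mem (by exact h),
          Set.indicator_of_mem (s := List.dropLast ⁻¹' S)
            (show (history Z (n + 1 + 1) ω).dropLast ∈ S by rwa [this])]
      · rw [Set.indicator_of_notMem (by exact h),
          Set.indicator_of_notMem (s := List.dropLast ⁻¹' S)
            (show ¬(history Z (n + 1 + 1) ω).dropLast ∈ S by rwa [this])]
    rw [h1, hZ.integral_succ hα₀ hα₁ hθ]
    refine integral_congr_ae ?_
    filter_upwards [hZ.ae_mem_labeledLists] with ω hω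
    by_cases h : history Z (n + 1) ω ∈ S
    · rw [Set.indicator_of_mem (by exact h), ← castMean_castNoise hα₁ hθ f
        (labeledLists_spec (hω _)).1 (history_succ_ne_nil _ _ _)]
      exact castMean_congr fun i => by simp [h]
    · rw [Set.indicator_of_notMem (by exact h)]
      rw [castMean_congr (g := fun _ => 0) fun i => by simp [h]]
      simp [castMean]

/-- The accumulated prediction errors converge if the mean square increments of `f` are
dominated by the decrease of the mean of a nonnegative function. -/
theorem IsCastingSequence.ae_exists_tendsto_castNoise (hZ : IsCastingSequence P α θ Z)
    (hα₀ : 0 < α) (hα₁ : α < 1) (hθ : -α < θ) {f φ : List ℕ → ℝ} (hφ : ∀ z, 0 ≤ φ z)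
    (h : ∀ z, IsLabeled z → z ≠ [] →
      castMean α θ (fun y => (f y - f z) ^ 2) z ≤ φ z - castMean α θ φ z) :
    ∀ᵐ ω ∂P, ∃ c, Tendsto (fun n => castNoise α θ f (history Z (n + 1) ω)) atTop (𝓝 c) := by
  -- The mean of noise² + φ never increases, since the decrease of φ pays for each new variance.
  -- Initially the noise is an empty sum.
  have hdec : ∀ n, ∫ ω, (castNoise α θ f (history Z (n + 1) ω) ^ 2 + φ (history Z (n + 1) ω)) ∂P ≤
      ∫ ω, φ (history Z 1 ω) ∂P := by
    intro n
    induction n with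
    | zero =>
      refine le_of_eq (integral_congr_ae (Eventually.of_forall fun ω => ?_))
      simp [castNoise]
    | succ n ih =>
      refine le_trans ?_ ih
      rw [hZ.integral_succ hα₀ hα₁ hθ (n + 1) fun z => castNoise α θ f z ^ 2 + φ z]
      refine hZ.integral_mono hα₀ hα₁ hθ n (g := fun z => castNoise α θ f z ^ 2 + φ z)
        fun z hz hz' => ?_
      have h1 := castMean_sq_sub_castMean_le hα₁ hθ hz f (castNoise α θ f z)
      have h2 := h z hz hz'
      have h3 : castMean α θ (fun z => castNoise α θ f z ^ 2 + φ z) z =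
          castMean α θ (fun y => (castNoise α θ f z + (f y - castMean α θ f z)) ^ 2) z +
            castMean α θ φ z := by
        rw [castMean_congr (g := fun y => (castNoise α θ f z + (f y - castMean α θ f z)) ^ 2 + φ y)
          fun i => by simp only [castNoise_append f hz' i]]
        simp only [castMean, mul_add, Finset.sum_add_distrib]
      linarith
  set C := ∫ ω, φ (history Z 1 ω) ∂P with hC
  -- The inequality |x| ≤ 1 + x² turns the L² bound into the L¹ bound needed for martingale
  -- convergence.
  have hL1 : ∀ n, ∫ ω, ‖castNoise α θ f (history Z (n + 1) ω)‖ ∂P ≤ 1 + C := by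
    intro n
    have h1 : ∫ ω, ‖castNoise α θ f (history Z (n + 1) ω)‖ ∂P ≤
        ∫ ω, (1 + (castNoise α θ f (history Z (n + 1) ω) ^ 2 + φ (history Z (n + 1) ω))) ∂P := by
      refine hZ.integral_mono hα₀ hα₁ hθ n (f := fun z => ‖castNoise α θ f z‖)
        (g := fun z => 1 + (castNoise α θ f z ^ 2 + φ z)) fun z _ _ => ?_
      rw [Real.norm_eq_abs, ← sq_abs]
      nlinarith [hφ z, sq_nonneg (|castNoise α θ f z| - 1), abs_nonneg (castNoise α θ f z)]
    refine h1.trans ?_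
    rw [integral_add (integrable_const _)
      (hZ.integrable hα₀ hα₁ hθ _ fun z => castNoise α θ f z ^ 2 + φ z)]
    simpa using hdec n
  refine (hZ.martingale_castNoise hα₀ hα₁ hθ f).submartingale.exists_ae_tendsto_of_bdd
    (R := (1 + C).toNNReal) fun n => ?_
  rw [eLpNorm_one_eq_lintegral_enorm,
    ← ofReal_integral_norm_eq_lintegral_enorm (hZ.integrable hα₀ hα₁ hθ _ _)]
  exact ENNReal.ofReal_le_ofReal (hL1 n)

/-! ### Growth of the number of actors -/

theorem IsCastingSequence.tendsto_integral_inv_numActors (hZ : IsCastingSequence P α θ Z)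
    (hα₀ : 0 < α) (hα₁ : α < 1) (hθ : -α < θ) :
    Tendsto (fun n => ∫ ω, 1 / (numActors (history Z (n + 1) ω) : ℝ) ∂P) atTop (𝓝 0) := by
  have h1θ : 0 < 1 + θ := by linarith
  -- The half absorbs V + 1 ≤ 2V when 1/V - 1/(V+1) is compared with a multiple of 1/V².
  set c := min α (θ + α) / 2
  have hc : 0 < c := half_pos (lt_min hα₀ (by linarith))
  have ha0 : ∀ n : ℕ, 0 ≤ 1 / ((n : ℝ) + (1 + θ)) := fun n => by positivity
  refine tendsto_zero_of_le_contraction (e := fun _ => 0) hc (fun n => ?_) ha0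
    (tendsto_one_div_natCast_add _) (tendsto_sum_one_div_natCast_add h1θ) tendsto_const_nhds
    fun n => ?_
  · exact integral_nonneg fun ω => by positivity
  have key : ∀ z, IsLabeled z → z ≠ [] →
      castMean α θ (fun y => 1 / (numActors y : ℝ)) z ≤
        (1 - c * (1 / (z.length + θ))) * (1 / (numActors z : ℝ)) := by
    intro z hz hz'
    rw [castMean_inv_numActors hα₁ hθ hz hz']
    have hV : (1 : ℝ) ≤ numActors z := by exact_mod_cast numActors_pos hz'
    have hL := length_add_pos hα₁ hθ hz'
    have hW : 2 * c * numActors z ≤ θ + α * numActors z := by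
      rcases le_total 0 θ with h | h
      · have : 2 * c ≤ α := by simp only [c]; linarith [min_le_left α (θ + α)]
        nlinarith
      · have : 2 * c ≤ θ + α := by simp only [c]; linarith [min_le_right α (θ + α)]
        nlinarith
    have hcc : c / numActors z ≤
        (θ + α * numActors z) / (numActors z * (numActors z + 1)) := by
      rw [div_le_div_iff₀ (by positivity) (by positivity)]
      nlinarith [mul_nonneg hc.le (sub_nonneg.2 hV)]
    have := div_le_div_of_nonneg_right hcc hL.le
    have e : (1 - c * (1 / (z.length + θ))) * (1 / (numActors z : ℝ)) =
        1 / (numActors z : ℝ) - c / numActors z / (z.length + θ) := by ring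
    rw [e]; linarith
  have h2 := hZ.integral_succ hα₀ hα₁ hθ (n + 1) fun y => 1 / (numActors y : ℝ)
  have h3 := hZ.integral_mono hα₀ hα₁ hθ n key
  rw [h2, mul_zero, add_zero]
  refine h3.trans ?_
  simp only [length_history]
  rw [integral_const_mul]
  refine mul_le_mul_of_nonneg_right ?_ (integral_nonneg fun ω => by positivity)
  refine (le_abs_self _).trans_eq ?_
  push_cast
  ring_nf

theorem IsCastingSequence.ae_tendsto_numActors (hZ : IsCastingSequence P α θ Z)
    (hα₀ : 0 < α) (hα₁ : α < 1) (hθ : -α < θ) :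
    ∀ᵐ ω ∂P, Tendsto (fun n => numActors (history Z n ω)) atTop atTop := by
  have h : ∀ᵐ ω ∂P, ∀ K : ℕ, ∃ n, K < numActors (history Z n ω) := by
    rw [ae_all_iff]
    intro K
    rw [ae_iff]
    set A := {ω | ¬∃ n, K < numActors (history Z n ω)}
    have hA : MeasurableSet A := by
      have : A = ⋂ n, history Z n ⁻¹' {z | ¬ K < numActors z} := by
        ext ω; simp [A]
      rw [this]
      exact MeasurableSet.iInter fun n => measurableSet_history_preimage hZ.measurableSet_fiber n _
    -- On A the number of actors never exceeds K, so the mean of 1/V could not tend to 0 if A had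
    -- positive probability. The bound uses K + 1 so that K = 0 also gives a positive factor.
    have hle : ∀ n, P.real A * (1 / (K + 1)) ≤
        ∫ ω, 1 / (numActors (history Z (n + 1) ω) : ℝ) ∂P := by
      intro n
      rw [← smul_eq_mul, ← integral_indicator_const _ hA]
      refine MeasureTheory.integral_mono ((integrable_const _).indicator hA)
        (hZ.integrable hα₀ hα₁ hθ _ fun z => 1 / (numActors z : ℝ)) fun ω => ?_
      by_cases hω : ω ∈ A
      · rw [Set.indicator_of_mem hω]
        have h1 : numActors (history Z (n + 1) ω) ≤ K := by
          by_contra h; exact hω ⟨_, not_le.1 h⟩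
        have h2 := numActors_pos (history_succ_ne_nil Z n ω)
        have h3 : (numActors (history Z (n + 1) ω) : ℝ) ≤ K := by exact_mod_cast h1
        have h4 : (0 : ℝ) < numActors (history Z (n + 1) ω) := by exact_mod_cast h2
        exact one_div_le_one_div_of_le h4 (by linarith)
      · rw [Set.indicator_of_notMem hω]; positivity
    have h0 := ge_of_tendsto' (hZ.tendsto_integral_inv_numActors hα₀ hα₁ hθ) hle
    have h1 : P.real A = 0 := by
      refine le_antisymm ?_ measureReal_nonneg
      by_contra h
      exact absurd h0 (not_le.2 (mul_pos (not_le.1 h) (by positivity)))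
    exact (measureReal_eq_zero_iff).1 h1
  filter_upwards [h] with ω hω
  exact tendsto_atTop_atTop_of_monotone (numActors_history_mono Z ω) fun K =>
    (hω K).imp fun n hn => hn.le

/-! ### Limits of the tail proportions -/

/-- The limiting proportion of actors with more than `k` roles. -/
noncomputable def limitTail (α : ℝ) (k : ℕ) : ℝ :=
  (ascPochhammer ℝ k).eval (1 - α) / (k.factorial : ℝ)

/-- This is the equation for the zero of the limiting drift. -/
theorem limitTail_succ (α : ℝ) (k : ℕ) :
    (k + 1) * limitTail α (k + 1) = (k + 1 - α) * limitTail α k := by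
  rw [limitTail, limitTail, ascPochhammer_succ_right, Nat.factorial_succ]
  simp only [Polynomial.eval_mul, Polynomial.eval_add, Polynomial.eval_X,
    Polynomial.eval_natCast]
  push_cast
  field_simp
  ring

theorem limitTail_sub (α : ℝ) (k : ℕ) :
    limitTail α k - limitTail α (k + 1) = limitDegree α (k + 1) := by
  have h := limitTail_succ α k
  have h1 : ((k : ℝ) + 1) ≠ 0 := by positivity
  rw [mul_comm, ← eq_div_iff h1] at h
  rw [h, limitDegree, limitTail, Nat.factorial_succ, Nat.add_sub_cancel]
  push_cast
  field_simp
  ring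

theorem IsCastingSequence.ae_tendsto_tailProportion (hZ : IsCastingSequence P α θ Z)
    (hα₀ : 0 < α) (hα₁ : α < 1) (hθ : -α < θ) :
    ∀ᵐ ω ∂P, ∀ k, Tendsto (fun n => tailProportion (k + 1) (history Z (n + 1) ω)) atTop
      (𝓝 (limitTail α k)) := by
  have hnoise : ∀ᵐ ω ∂P, ∀ k, ∃ c, Tendsto
      (fun n => castNoise α θ (tailProportion (k + 2)) (history Z (n + 1) ω)) atTop (𝓝 c) := by
    rw [ae_all_iff]
    intro k
    obtain ⟨C, hC, h⟩ := exists_castMean_tailProportion_sq_le hα₀ hα₁ hθ k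
    refine hZ.ae_exists_tendsto_castNoise hα₀ hα₁ hθ (φ := fun z => C * (1 / numActors z))
      (fun z => by positivity) fun z hz hz' => (h z hz hz').trans_eq ?_
    rw [mul_sub]
    congr 1
    simp only [castMean, Finset.mul_sum]
    exact Finset.sum_congr rfl fun i _ => by ring
  filter_upwards [hnoise, hZ.ae_tendsto_numActors hα₀ hα₁ hθ, hZ.ae_mem_labeledLists]
    with ω hω hV hlab k
  have hV1 : Tendsto (fun n => (1 : ℝ) / ((numActors (history Z (n + 1) ω) : ℝ) + 1)) atTop
      (𝓝 0) := by
    refine tendsto_const_nhds.div_atTop (Tendsto.atTop_add ?_ tendsto_const_nhds)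
    exact tendsto_natCast_atTop_atTop.comp (hV.comp (tendsto_add_atTop_nat 1))
  have h1θ : 0 < 1 + θ := by linarith
  induction k with
  | zero =>
    refine tendsto_const_nhds.congr fun n => ?_
    have := numActors_pos (history_succ_ne_nil Z n ω)
    rw [tailProportion, numAtLeast_one, div_self (by positivity)]
    simp [limitTail]
  | succ k ih =>
    obtain ⟨s, hs⟩ := hω k
    refine tendsto_of_stochastic_approximation (c := k + 1) (a := fun n => 1 / ((n : ℝ) + (1 + θ)))
      (b := fun n => (k + 1 - α) * tailProportion (k + 1) (history Z (n + 1) ω) +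
        (α - θ) * (1 / (numActors (history Z (n + 1) ω) + 1)) *
          tailProportion (k + 2) (history Z (n + 1) ω)) (by positivity)
      (fun n => by positivity) (tendsto_one_div_natCast_add _)
      (tendsto_sum_one_div_natCast_add h1θ) ?_ hs fun n => ?_
    · rw [limitTail_succ, ← add_zero ((k + 1 - α) * limitTail α k)]
      refine (ih.const_mul _).add ?_
      -- The correction to the drift dies out because V → ∞ and proportions are bounded by 1.
      refine Tendsto.zero_mul_isBoundedUnder_le (by simpa using hV1.const_mul (α - θ)) ?_
      refine isBoundedUnder_of ⟨1, fun n => ?_⟩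
      rw [Function.comp, Real.norm_eq_abs, abs_of_nonneg (tailProportion_nonneg _ _)]
      exact tailProportion_le_one _ _
    · have h1 := castMean_tailProportion hα₁ hθ (labeledLists_spec (hlab (n + 1))).1
        (history_succ_ne_nil Z n ω) k
      have h2 := castNoise_append (α := α) (θ := θ) (tailProportion (k + 2))
        (history_succ_ne_nil Z n ω) (Z (n + 1) ω)
      rw [← history_succ, h1, length_history] at h2
      have h3 : (n : ℝ) + (1 + θ) = ((n + 1 : ℕ) : ℝ) + θ := by push_cast; ring
      rw [h3]
      linarith

end

end Hollywood

/-! ### From movies to roles -/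

/-- Countable additivity over the fibers of T. It lets a conditional probability forget how the past
roles were split into movies, or how many there were. -/
theorem measure_preimage_inter_eq_mul {Ω ι : Type*} [MeasurableSpace Ω] [Countable ι]
    {μ : Measure Ω} {T : Ω → ι} (hT : ∀ t, MeasurableSet (T ⁻¹' {t})) {S : Set ι} {A : Set Ω}
    {c : ENNReal} (h : ∀ t ∈ S, μ (T ⁻¹' {t} ∩ A) = c * μ (T ⁻¹' {t})) :
    μ (T ⁻¹' S ∩ A) = c * μ (T ⁻¹' S) := by
  have hTS : MeasurableSet (T ⁻¹' S) := by
    rw [← Set.biUnion_preimage_singleton]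
    exact MeasurableSet.biUnion S.to_countable fun t _ => hT t
  rw [← Measure.restrict_apply hTS,
    ← tsum_measure_preimage_singleton S.to_countable fun t _ => hT t,
    ← tsum_measure_preimage_singleton S.to_countable fun t _ => hT t, ← ENNReal.tsum_mul_left]
  exact tsum_congr fun t => by rw [Measure.restrict_apply (hT t), h t t.2]

namespace Hollywood

section

variable {Ω : Type*} {X : ℕ → Ω → List ℕ}

theorem rolesBefore_succ (x : ℕ → List ℕ) (n : ℕ) :
    rolesBefore x (n + 1) = rolesBefore x n ++ x n := by
  simp [rolesBefore, List.range_succ]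

theorem history_eq_iff {β : Type*} (X : ℕ → Ω → β) (n : ℕ) (ω : Ω) (x : ℕ → β) :
    history X n ω = (List.range n).map x ↔ ∀ i < n, X i ω = x i := by
  simp [history]

theorem prefix_rolesBefore (x : ℕ → List ℕ) {m n : ℕ} (h : m ≤ n) :
    rolesBefore x m <+: rolesBefore x n := by
  induction n, h using Nat.le_induction with
  | base => exact List.prefix_rfl
  | succ n _ ih => exact ih.trans (by rw [rolesBefore_succ]; exact List.prefix_append _ _)

theorem le_length_rolesBefore {x : ℕ → List ℕ} (hx : ∀ n, x n ≠ []) (n : ℕ) :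
    n ≤ (rolesBefore x n).length := by
  induction n with
  | zero => simp
  | succ n ih =>
    rw [rolesBefore_succ, List.length_append]
    have := List.length_pos_iff.2 (hx n)
    omega

/-- The `j`-th role of a sequence of movies. -/
def role (X : ℕ → Ω → List ℕ) (j : ℕ) (ω : Ω) : ℕ :=
  (rolesBefore (fun i => X i ω) (j + 1)).getD j 0

/-- Without empty movies, the first j+1 movies contain at least j+1 roles, so the default value in
`role` is never read. -/
theorem history_role {ω : Ω} (hω : ∀ n, X n ω ≠ []) {m n : ℕ} (h : m ≤ n) :
    history (role X) m ω = (rolesBefore (fun i => X i ω) n).take m := by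
  have hn := le_length_rolesBefore hω n
  refine List.ext_getElem (by simp; omega) fun j h1 h2 => ?_
  rw [length_history] at h1
  have hj := le_length_rolesBefore hω (j + 1)
  simp only [history, List.getElem_map, List.getElem_range, List.getElem_take, role]
  rw [List.getD_eq_getElem _ _ (by omega)]
  exact (prefix_rolesBefore (fun i => X i ω) (by omega : j + 1 ≤ n)).getElem _

theorem history_role_length {ω : Ω} (hω : ∀ n, X n ω ≠ []) (n : ℕ) :
    history (role X) (rolesBefore (fun i => X i ω) n).length ω =
      rolesBefore (fun i => X i ω) n := by
  rw [history_role hω le_rfl, ← List.prefix_iff_eq_take.1]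
  exact prefix_rolesBefore _ (le_length_rolesBefore hω n)

/-! ### Network degrees as counts in the concatenated roles -/

theorem numVertices_network (X : ℕ → Ω → List ℕ) (n : ℕ) (ω : Ω) :
    (network X n ω).numVertices = numActors (rolesBefore (fun i => X i ω) n) := by
  change (InteractionProcess.vertices fun i : Fin n => X i ω).ncard = _
  rw [numActors, ← Set.ncard_coe_finset]
  congr 1
  ext a
  simp only [InteractionProcess.vertices, rolesBefore, Set.mem_ofPred_eq, List.coe_toFinset,
    List.mem_flatten, List.mem_map, List.mem_range]
  constructor
  · rintro ⟨i, hi⟩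
    exact ⟨_, ⟨i, i.2, rfl⟩, hi⟩
  · rintro ⟨_, ⟨i, hi, rfl⟩, ha⟩
    exact ⟨⟨i, hi⟩, ha⟩

theorem degree_eq_count_rolesBefore (x : ℕ → List ℕ) (n a : ℕ) :
    InteractionProcess.degree (fun i : Fin n => x i) a = (rolesBefore x n).count a := by
  rw [InteractionProcess.degree, Fin.sum_univ_eq_sum_range fun i => (x i).count a]
  induction n with
  | zero => simp [rolesBefore]
  | succ n ih => rw [Finset.sum_range_succ, ih, rolesBefore_succ, List.count_append]

theorem numDegree_network (X : ℕ → Ω → List ℕ) (n : ℕ) (ω : Ω) {k : ℕ} (hk : 1 ≤ k) :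
    (network X n ω).numDegree k = ((rolesBefore (fun i => X i ω) n).toFinset.filter
      fun a => (rolesBefore (fun i => X i ω) n).count a = k).card := by
  change {a | a ∈ InteractionProcess.vertices (fun i : Fin n => X i ω) ∧
    InteractionProcess.degree (fun i : Fin n => X i ω) a = k}.ncard = _
  rw [← Set.ncard_coe_finset]
  congr 1
  ext a
  simp only [degree_eq_count_rolesBefore (fun i => X i ω), Finset.coe_filter, Set.mem_ofPred_eq,
    List.mem_toFinset]
  refine and_congr_left fun h => ⟨fun _ => List.count_pos_iff.1 (by omega), fun ha => ?_⟩
  simp only [rolesBefore, List.mem_flatten, List.mem_map, List.mem_range] at ha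
  obtain ⟨_, ⟨i, hi, rfl⟩, ha⟩ := ha
  exact ⟨⟨i, hi⟩, ha⟩

variable [MeasurableSpace Ω] {P : Measure Ω} {α θ : ℝ} {ν : PMF ℕ}

theorem IsInteractionSequence.prob_history_inter (hX : IsInteractionSequence P α θ ν X) (n : ℕ)
    (y : List (List ℕ)) (s : List ℕ) :
    P (history X n ⁻¹' {y} ∩ {ω | X n ω = s}) =
      (ν s.length * ENNReal.ofReal (movieProb α θ y.flatten s)) * P (history X n ⁻¹' {y}) := by
  by_cases hy : y.length = n
  -- A sequence starting with y and then s, as `prob_succ` requires; its terms after index n play no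
  -- role.
  · set x : ℕ → List ℕ := fun i => if i < n then y.getD i [] else s with hx
    have hyx : y = (List.range n).map x := by
      refine List.ext_getElem (by simp [hy]) fun i h1 h2 => ?_
      simp [hx, hy ▸ h1, h1]
    have hxn : x n = s := by simp [hx]
    have h := hX.prob_succ n x
    have e1 : {ω | ∀ i < n, X i ω = x i} = history X n ⁻¹' {y} := by
      ext ω
      rw [Set.mem_preimage, Set.mem_singleton_iff, hyx, history_eq_iff]
      rfl
    have e2 : {ω | ∀ i < n + 1, X i ω = x i} = history X n ⁻¹' {y} ∩ {ω | X n ω = s} := by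
      rw [← e1]
      ext ω
      simp only [Set.mem_ofPred_eq, Set.mem_inter_iff, Nat.forall_lt_succ_right, hxn]
    have e3 : rolesBefore x n = y.flatten := by rw [rolesBefore, ← hyx]
    rw [e1, e2, e3, hxn] at h
    rw [h, mul_comm]
  · have : history X n ⁻¹' {y} = ∅ := by
      ext ω
      simp only [Set.mem_preimage, Set.mem_singleton_iff, Set.mem_empty_iff_false, iff_false]
      rintro rfl
      simp at hy
    simp [this]

theorem IsInteractionSequence.measurableSet_history (hX : IsInteractionSequence P α θ ν X) (n : ℕ)
    (S : Set (List (List ℕ))) : MeasurableSet (history X n ⁻¹' S) :=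
  measurableSet_history_preimage hX.measurableSet_eq n S

theorem IsInteractionSequence.measurableSet_rolesBefore (hX : IsInteractionSequence P α θ ν X)
    (n : ℕ) (p : List ℕ → Prop) : MeasurableSet {ω | p (rolesBefore (fun i => X i ω) n)} :=
  hX.measurableSet_history n {y | p y.flatten}

theorem IsInteractionSequence.prob_rolesBefore_inter (hX : IsInteractionSequence P α θ ν X) (n : ℕ)
    (a s : List ℕ) :
    P ({ω | rolesBefore (fun i => X i ω) n = a} ∩ {ω | X n ω = s}) =
      (ν s.length * ENNReal.ofReal (movieProb α θ a s)) *
        P {ω | rolesBefore (fun i => X i ω) n = a} := by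
  refine measure_preimage_inter_eq_mul (T := history X n) (S := {y | y.flatten = a})
    (fun y => hX.measurableSet_history n _) ?_
  rintro y rfl
  exact hX.prob_history_inter n y s

theorem IsInteractionSequence.ae_ne_nil (hX : IsInteractionSequence P α θ ν X) (hν : ν 0 = 0) :
    ∀ᵐ ω ∂P, ∀ n, X n ω ≠ [] := by
  rw [ae_all_iff]
  intro n
  have h := measure_preimage_inter_eq_mul (μ := P) (T := history X n) (S := Set.univ)
    (A := {ω | X n ω = []}) (c := 0) (fun y => hX.measurableSet_history n _) fun y _ => by
      rw [hX.prob_history_inter]; simp [hν]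
  rw [Set.preimage_univ, Set.univ_inter, zero_mul] at h
  filter_upwards [measure_eq_zero_iff_ae_notMem.1 h] with ω hω using hω

/-- Given its number of roles, the first `n` movies are cast like one movie. -/
theorem IsInteractionSequence.exists_prob_rolesBefore_eq [IsProbabilityMeasure P]
    (hX : IsInteractionSequence P α θ ν X)
    (hα₀ : 0 < α) (hα₁ : α < 1) (hθ : -α < θ) (n : ℕ) :
    ∃ l : ℕ → ENNReal, ∀ r : List ℕ, P {ω | rolesBefore (fun i => X i ω) n = r} =
      ENNReal.ofReal (movieProb α θ [] r) * l r.length := by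
  induction n with
  | zero =>
    refine ⟨fun N => if N = 0 then 1 else 0, fun r => ?_⟩
    by_cases hr : r = []
    · simp [hr, rolesBefore, movieProb]
    · have : ¬ [] = r := fun h => hr h.symm
      simp [hr, rolesBefore, this]
  | succ n ih =>
    obtain ⟨l, hl⟩ := ih
    -- The convolution of l with ν: r is cut where the last movie starts, and `movieProb` factors at
    -- the cut.
    refine ⟨fun N => ∑ j ∈ Finset.range (N + 1), l j * ν (N - j), fun r => ?_⟩
    have hU : {ω | rolesBefore (fun i => X i ω) (n + 1) = r} =
        ⋃ j ∈ Finset.range (r.length + 1),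
          ({ω | rolesBefore (fun i => X i ω) n = r.take j} ∩ {ω | X n ω = r.drop j}) := by
      ext ω
      simp only [rolesBefore_succ, Set.mem_ofPred_eq, Set.mem_iUnion, Finset.mem_range,
        Set.mem_inter_iff, exists_prop]
      constructor
      · rintro rfl
        exact ⟨(rolesBefore (fun i => X i ω) n).length, by simp, by simp, by simp⟩
      · rintro ⟨j, -, h1, h2⟩
        rw [h1, h2, List.take_append_drop]
    rw [hU, measure_biUnion_finset, Finset.mul_sum]
    · refine Finset.sum_congr rfl fun j hj => ?_
      rw [Finset.mem_range] at hj
      rw [hX.prob_rolesBefore_inter, hl, List.length_take_of_le (by omega), List.length_drop]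
      have : movieProb α θ [] r =
          movieProb α θ [] (r.take j) * movieProb α θ (r.take j) (r.drop j) := by
        conv_lhs => rw [← List.take_append_drop j r, movieProb_append, List.nil_append]
      rw [this, ENNReal.ofReal_mul (movieProb_nil_nonneg_and hα₀ hα₁ hθ _).1]
      ring
    · intro i hi j hj hij
      rw [Finset.coe_range, Set.mem_Iio] at hi hj
      refine Set.disjoint_left.2 fun ω h1 h2 => hij ?_
      have := congrArg List.length (h1.1.symm.trans h2.1)
      rwa [List.length_take_of_le (by omega), List.length_take_of_le (by omega)] at this
    · exact fun j _ => (hX.measurableSet_rolesBefore n (· = r.take j)).inter (hX.measurableSet_eq n _)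

theorem IsInteractionSequence.prob_prefix_and_length [IsProbabilityMeasure P]
    (hX : IsInteractionSequence P α θ ν X)
    (hα₀ : 0 < α) (hα₁ : α < 1) (hθ : -α < θ) (n : ℕ) {z : List ℕ} {N : ℕ} (hz : z.length ≤ N) :
    P {ω | (rolesBefore (fun i => X i ω) n).length = N ∧ z <+: rolesBefore (fun i => X i ω) n} =
      ENNReal.ofReal (movieProb α θ [] z) *
        P {ω | (rolesBefore (fun i => X i ω) n).length = N} := by
  obtain ⟨l, hl⟩ := hX.exists_prob_rolesBefore_eq hα₀ hα₁ hθ n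
  -- Induction on the number d of roles missing after z. Summing over the next role costs nothing
  -- because the casting probabilities add up to 1.
  have key : ∀ (d : ℕ) (z : List ℕ), z.length + d = N →
      P {ω | (rolesBefore (fun i => X i ω) n).length = N ∧ z <+: rolesBefore (fun i => X i ω) n} =
        ENNReal.ofReal (movieProb α θ [] z) * l N := by
    intro d
    induction d with
    | zero =>
      intro z hz
      rw [add_zero] at hz
      subst hz
      rw [← hl]
      congr 1
      ext ω
      constructor
      · rintro ⟨h1, h2⟩
        exact (h2.eq_of_length h1.symm).symm
      · rintro h
        simp only [Set.mem_ofPred_eq] at h ⊢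
        rw [h]; exact ⟨rfl, List.prefix_rfl⟩
    | succ d ih =>
      intro z hz
      have hU : {ω | (rolesBefore (fun i => X i ω) n).length = N ∧
          z <+: rolesBefore (fun i => X i ω) n} =
          ⋃ i : ℕ, {ω | (rolesBefore (fun i => X i ω) n).length = N ∧
            (z ++ [i]) <+: rolesBefore (fun i => X i ω) n} := by
        ext ω
        simp only [Set.mem_ofPred_eq, Set.mem_iUnion]
        constructor
        · rintro ⟨h1, t, h2⟩
          obtain _ | ⟨i, t⟩ := t
          · rw [← h2] at h1; simp at h1; omega
          · exact ⟨i, h1, t, by rw [← h2]; simp⟩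
        · rintro ⟨i, h1, h2⟩
          exact ⟨h1, (List.prefix_append _ _).trans h2⟩
      rw [hU, measure_iUnion]
      · have h1 : ∀ i, P {ω | (rolesBefore (fun i => X i ω) n).length = N ∧
            (z ++ [i]) <+: rolesBefore (fun i => X i ω) n} =
            ENNReal.ofReal (movieProb α θ [] z) * l N * ENNReal.ofReal (castProb α θ z i) := by
          intro i
          rw [ih (z ++ [i]) (by simp; omega), movieProb_nil_append_singleton,
            ENNReal.ofReal_mul (movieProb_nil_nonneg_and hα₀ hα₁ hθ _).1]
          ring
        rw [tsum_congr h1, ENNReal.tsum_mul_left]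
        by_cases hw : movieProb α θ [] z = 0
        · simp [hw]
        have hlab := (movieProb_nil_nonneg_and hα₀ hα₁ hθ z).2 hw
        rw [tsum_eq_sum (s := Finset.Icc 1 (numActors z + 1))
          fun i hi => by rw [castProb_eq_zero hi, ENNReal.ofReal_zero],
          ← ENNReal.ofReal_sum_of_nonneg fun i _ => castProb_nonneg hα₀ hα₁ hθ hlab i,
          sum_castProb hα₁ hθ hlab, ENNReal.ofReal_one, mul_one]
      · intro i j hij
        refine Set.disjoint_left.2 fun ω h1 h2 => hij ?_
        have := (List.prefix_of_prefix_length_le h1.2 h2.2 (by simp)).eq_of_length (by simp)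
        simpa using this
      · exact fun i => hX.measurableSet_rolesBefore n fun r => r.length = N ∧ (z ++ [i]) <+: r
  rw [key (N - z.length) z (by omega)]
  congr 1
  -- The empty prefix identifies l N as the probability of total length N.
  have h0 := key N [] (by simp)
  simpa [movieProb] using h0.symm

/-- The total length is averaged out. Lengths below that of z have probability 0, since n nonempty
movies have at least n roles. -/
theorem IsInteractionSequence.prob_prefix [IsProbabilityMeasure P]
    (hX : IsInteractionSequence P α θ ν X) (hν : ν 0 = 0)
    (hα₀ : 0 < α) (hα₁ : α < 1) (hθ : -α < θ) {n : ℕ} {z : List ℕ} (hz : z.length ≤ n) :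
    P {ω | z <+: rolesBefore (fun i => X i ω) n} = ENNReal.ofReal (movieProb α θ [] z) := by
  have h := measure_preimage_inter_eq_mul (μ := P) (S := Set.univ)
    (T := fun ω => (rolesBefore (fun i => X i ω) n).length)
    (A := {ω | z <+: rolesBefore (fun i => X i ω) n}) (c := ENNReal.ofReal (movieProb α θ [] z))
    (fun N => hX.measurableSet_rolesBefore n fun r => r.length = N) fun N _ => by
      by_cases hN : z.length ≤ N
      · exact hX.prob_prefix_and_length hα₀ hα₁ hθ n hN
      · have h0 : P ((fun ω => (rolesBefore (fun i => X i ω) n).length) ⁻¹' {N}) = 0 := by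
          rw [measure_eq_zero_iff_ae_notMem]
          filter_upwards [hX.ae_ne_nil hν] with ω hω hN'
          have h1 := le_length_rolesBefore hω n
          have h2 : (rolesBefore (fun i => X i ω) n).length = N := hN'
          omega
        rw [h0, mul_zero]
        exact measure_mono_null Set.inter_subset_left h0
  simpa using h

theorem IsInteractionSequence.isCastingSequence_role [IsProbabilityMeasure P]
    (hX : IsInteractionSequence P α θ ν X) (hν : ν 0 = 0)
    (hα₀ : 0 < α) (hα₁ : α < 1) (hθ : -α < θ) : IsCastingSequence P α θ (role X) where
  measurableSet_fiber j i := hX.measurableSet_rolesBefore (j + 1) fun r => r.getD j 0 = i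
  law z := by
    rw [← hX.prob_prefix hν hα₀ hα₁ hθ (le_refl z.length)]
    refine measure_congr ?_
    filter_upwards [hX.ae_ne_nil hν] with ω hω
    refine propext ?_
    change history (role X) z.length ω = z ↔ z <+: _
    rw [history_role hω le_rfl, List.prefix_iff_eq_take, eq_comm]

theorem IsInteractionSequence.ae_tendsto_degreeProportion [IsProbabilityMeasure P]
    (hX : IsInteractionSequence P α θ ν X) (hν : ν 0 = 0)
    (hα₀ : 0 < α) (hα₁ : α < 1) (hθ : -α < θ) :
    ∀ᵐ ω ∂P, ∀ k : ℕ, 1 ≤ k →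
      Tendsto (fun n => (network X n ω).degreeProportion k) atTop (𝓝 (limitDegree α k)) := by
  have hZ := hX.isCastingSequence_role hν hα₀ hα₁ hθ
  filter_upwards [hZ.ae_tendsto_tailProportion hα₀ hα₁ hθ, hX.ae_ne_nil hν] with ω hω hne k hk
  obtain ⟨k, rfl⟩ : ∃ j, k = j + 1 := ⟨k - 1, by omega⟩
  have h := (hω k).sub (hω (k + 1))
  rw [limitTail_sub] at h
  -- The limits along the roles are stated for histories of length n + 1, hence the shift by one in
  -- the time change.
  have hlen : Tendsto (fun n => (rolesBefore (fun i => X i ω) n).length - 1) atTop atTop :=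
    tendsto_atTop_mono (fun n => Nat.sub_le_sub_right (le_length_rolesBefore hne n) 1)
      (tendsto_sub_atTop_nat 1)
  refine (h.comp hlen).congr' ?_
  filter_upwards [eventually_ge_atTop 1] with n hn
  have := le_length_rolesBefore hne n
  simp only [Function.comp]
  rw [Nat.sub_add_cancel (by omega), history_role_length hne, EdgeLabeledNetwork.degreeProportion,
    numVertices_network, numDegree_network X n ω hk, tailProportion, tailProportion, ← sub_div]
  congr 1
  rw [sub_eq_iff_eq_add]
  exact_mod_cast (card_count_eq_add (k + 1) _).symm

end

/-! ### The power law -/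

theorem limitDegree_pos {α : ℝ} (hα₀ : 0 < α) (hα₁ : α < 1) (k : ℕ) : 0 < limitDegree α k := by
  have := ascPochhammer_pos (k - 1) (1 - α) (by linarith)
  unfold limitDegree
  positivity

/-- The denominator of Euler's formula at -α is -α (1-α)^{↑k}, and (1-α)^{↑k} = (1-α)^{↑(k-1)}
(k-α). -/
theorem gammaSeq_neg_eq {α : ℝ} (hα₀ : 0 < α) (hα₁ : α < 1) {k : ℕ} (hk : 1 ≤ k) :
    Real.GammaSeq (-α) k = -((k : ℝ) ^ (-α) / (limitDegree α k * (k - α))) := by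
  obtain ⟨j, rfl⟩ : ∃ j, k = j + 1 := ⟨k - 1, by omega⟩
  have hprod : ∀ n : ℕ, ∏ i ∈ Finset.range (n + 1), (-α + i) =
      -α * (ascPochhammer ℝ n).eval (1 - α) := by
    intro n
    induction n with
    | zero => simp
    | succ n ih =>
      rw [Finset.prod_range_succ, ih, ascPochhammer_succ_right]
      simp only [Polynomial.eval_mul, Polynomial.eval_add, Polynomial.eval_X,
        Polynomial.eval_natCast]
      push_cast
      ring
  have h1 := ascPochhammer_pos j (1 - α) (by linarith)
  have h2 : (0 : ℝ) < (j : ℝ) + 1 - α := by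
    have : (0 : ℝ) ≤ j := by positivity
    linarith
  rw [Real.GammaSeq, hprod, limitDegree, ascPochhammer_succ_right]
  simp only [Polynomial.eval_mul, Polynomial.eval_add, Polynomial.eval_X,
    Polynomial.eval_natCast, Nat.add_sub_cancel]
  have h3 : (1 : ℝ) - α + j ≠ 0 := by linarith
  have h4 : (j : ℝ) + 1 - α ≠ 0 := h2.ne'
  have h5 : ((j + 1).factorial : ℝ) ≠ 0 := by positivity
  push_cast
  rw [show (1 : ℝ) - α + j = j + 1 - α by ring]
  field_simp

theorem tendsto_limitDegree_mul_rpow {α : ℝ} (hα₀ : 0 < α) (hα₁ : α < 1) :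
    Tendsto (fun k : ℕ => limitDegree α k * (k : ℝ) ^ (1 + α)) atTop
      (𝓝 (α / Real.Gamma (1 - α))) := by
  have hΓ : Real.Gamma (1 - α) = -α * Real.Gamma (-α) := by
    rw [← Real.Gamma_add_one (by linarith)]; ring_nf
  have hΓpos : 0 < Real.Gamma (1 - α) := Real.Gamma_pos_of_pos (by linarith)
  have hΓ0 : Real.Gamma (-α) ≠ 0 := by
    intro h; rw [h, mul_zero] at hΓ; exact hΓpos.ne' hΓ
  have h1 : Tendsto (fun k : ℕ => (1 - α / (k : ℝ))) atTop (𝓝 (1 - 0)) :=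
    (tendsto_const_div_atTop_nhds_zero_nat α).const_sub 1
  rw [sub_zero] at h1
  have h2 := ((Real.GammaSeq_tendsto_Gamma (-α)).neg.mul h1).inv₀ (by simpa using hΓ0)
  have e : α / Real.Gamma (1 - α) = (-Real.Gamma (-α) * 1)⁻¹ := by
    rw [hΓ]; field_simp
  rw [e]
  refine h2.congr' ?_
  filter_upwards [eventually_ge_atTop 1] with k hk
  have hk' : (1 : ℝ) ≤ k := by exact_mod_cast hk
  have hp := limitDegree_pos hα₀ hα₁ k
  have h3 : (0 : ℝ) < k - α := by linarith
  have h4 : (0 : ℝ) < (k : ℝ) ^ α := by positivity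
  rw [gammaSeq_neg_eq hα₀ hα₁ hk, neg_neg, Real.rpow_neg (by linarith),
    Real.rpow_add (by linarith), Real.rpow_one]
  have h5 : (1 : ℝ) - α / k = (k - α) / k := by field_simp
  rw [h5]
  field_simp

theorem limitDegree_isEquivalent {α : ℝ} (hα₀ : 0 < α) (hα₁ : α < 1) :
    (fun k : ℕ => limitDegree α k) ~[atTop]
      fun k : ℕ => α * (k : ℝ) ^ (-(α + 1)) / Real.Gamma (1 - α) := by
  have hΓpos : 0 < Real.Gamma (1 - α) := Real.Gamma_pos_of_pos (by linarith)
  refine (isEquivalent_iff_tendsto_one ?_).2 ?_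
  · filter_upwards [eventually_ge_atTop 1] with k hk
    have : (0 : ℝ) < k := by exact_mod_cast hk
    positivity
  · have h := (tendsto_limitDegree_mul_rpow hα₀ hα₁).div_const (α / Real.Gamma (1 - α))
    rw [div_self (by positivity)] at h
    refine h.congr' ?_
    filter_upwards [eventually_ge_atTop 1] with k hk
    have : (0 : ℝ) < k := by exact_mod_cast hk
    simp only [Pi.div_apply]
    rw [Real.rpow_neg this.le, add_comm α 1]
    field_simp

/-- A slowly varying function that interpolates the degree limits. -/
noncomputable def degreeSlowlyVarying (α x : ℝ) : ℝ :=
  limitDegree α ⌊x⌋₊ * (⌊x⌋₊ : ℝ) ^ (1 + α)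

theorem isSlowlyVarying_degreeSlowlyVarying {α : ℝ} (hα₀ : 0 < α) (hα₁ : α < 1) :
    IsSlowlyVarying (degreeSlowlyVarying α) := by
  have hΓpos : 0 < Real.Gamma (1 - α) := Real.Gamma_pos_of_pos (by linarith)
  have hlim : Tendsto (degreeSlowlyVarying α) atTop (𝓝 (α / Real.Gamma (1 - α))) :=
    (tendsto_limitDegree_mul_rpow hα₀ hα₁).comp tendsto_nat_floor_atTop
  have hpos : 0 < α / Real.Gamma (1 - α) := by positivity
  refine ⟨?_, hlim.eventually_const_lt hpos, fun t ht => ?_⟩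
  · exact (measurable_from_nat (f := fun k : ℕ => limitDegree α k * (k : ℝ) ^ (1 + α))).comp
      Nat.measurable_floor
  · have := (hlim.comp (tendsto_id.const_mul_atTop ht)).div hlim hpos.ne'
    rwa [div_self hpos.ne'] at this

/-- For fixed k the limit in n must equal l(k) k^{-γ} exactly. `degreeSlowlyVarying` is built to
achieve this at integers, and it varies slowly because it has a positive limit. -/
theorem hasPowerLawDegree_of_tendsto {α : ℝ} (hα₀ : 0 < α) (hα₁ : α < 1)
    {E : ∀ n : ℕ, EdgeLabeledNetwork n}
    (hE : ∀ k : ℕ, 1 ≤ k →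
      Tendsto (fun n => (E n).degreeProportion k) atTop (𝓝 (limitDegree α k))) :
    HasPowerLawDegree E (1 + α) := by
  refine ⟨by linarith, degreeSlowlyVarying α, isSlowlyVarying_degreeSlowlyVarying hα₀ hα₁, ?_⟩
  filter_upwards [eventually_ge_atTop 1] with k hk
  have hk' : (0 : ℝ) < k := by exact_mod_cast hk
  have : degreeSlowlyVarying α k * (k : ℝ) ^ (-(1 + α)) = limitDegree α k := by
    rw [degreeSlowlyVarying, Nat.floor_natCast, mul_assoc, ← Real.rpow_add hk', add_neg_cancel,
      Real.rpow_zero, mul_one]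
  rw [this]
  exact (isEquivalent_const_iff_tendsto (limitDegree_pos hα₀ hα₁ k).ne').2 (hE k hk)

end Hollywood

theorem theorem5p2 {Ω : Type*} [MeasurableSpace Ω] (P : Measure Ω) [IsProbabilityMeasure P]
    (α θ : ℝ) (hα₀ : 0 < α) (hα₁ : α < 1) (hθ : -α < θ)
    (ν : PMF ℕ) (hν : ν 0 = 0)
    (X : ℕ → Ω → List ℕ) (hX : Hollywood.IsInteractionSequence P α θ ν X) :
    (∀ᵐ ω ∂P, ∀ k : ℕ, 1 ≤ k →
      Tendsto
        (fun n : ℕ => ((Hollywood.network X n ω).numDegree k : ℝ) /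
          ((Hollywood.network X n ω).numVertices : ℝ))
        atTop (𝓝 (Hollywood.limitDegree α k))) ∧
    ((fun k : ℕ => Hollywood.limitDegree α k) ~[atTop]
      fun k : ℕ => α * (k : ℝ) ^ (-(α + 1)) / Real.Gamma (1 - α)) ∧
    1 + α ∈ Set.Ioo (1 : ℝ) 2 ∧
    (∀ᵐ ω ∂P, HasPowerLawDegree (fun n => Hollywood.network X n ω) (1 + α)) := by
  have h := hX.ae_tendsto_degreeProportion hν hα₀ hα₁ hθ
  refine ⟨h, Hollywood.limitDegree_isEquivalent hα₀ hα₁, ⟨by linarith, by linarith⟩, ?_⟩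
  filter_upwards [h] with ω hω
  exact Hollywood.hasPowerLawDegree_of_tendsto hα₀ hα₁ hω
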